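/- All C*-algebras and *-homomorphisms are unital. A Boolean σ-algebra is a Boolean algebra with countable suprema and infima; it need not be an algebra of sets. A σ-homomorphism of Boolean σ-algebras is a Boolean homomorphism preserving countable suprema. A $\sigma C^*$-algebra is a C*-algebra $\mathcal A$ in which every norm-bounded increasing sequence of self-adjoint elements has a supremum in $\mathcal A_{\mathrm{sa}}$. A positive linear map $\phi$ between C*-algebras is σ-normal if $\phi(a)=\sup_n\phi(a_n)$ whenever $(a_n)$ is a norm-bounded increasing sequence of self-adjoint elements with supremum $a$ among the self-adjoint elements; a σ-cpu map is a completely positive unital σ-normal map, and a σ-homomorphism of C*-algebras is a σ-normal $*$-homomorphism. For a Boolean σ-algebra $B$, let $\mathscr L^\infty_{\mathrm{abs}}(B)$ be the set of σ-homomorphisms $f$ from the Borel σ-algebra of $\mathbb C$ to $B$ such that $f(U)=\top$ for some bounded Borel set $U$. It is a commutative C*-algebra as follows. For $f,g$ let $\langle f,g\rangle$ be the unique σ-homomorphism from the Borel σ-algebra of $\mathbb C^2$ to $B$ with $\langle f,g\rangle(U\times V)=f(U)\wedge g(V)$; then $(f+g)(U)=\langle f,g\rangle(\{(z,w): z+w\in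 U\})$, $(fg)(U)=\langle f,g\rangle(\{(z,w): zw\in U\})$, $(\lambda f)(U)=f(\{z:\lambda z\in U\})$, $f^*(U)=f(\{z:\bar z\in U\})$ and $\|f\|=\inf\{r\ge 0: f(\{|z|\le r\})=\top\}$. For $p\in B$ let $\chi_p\in\mathscr L^\infty_{\mathrm{abs}}(B)$ be the element with $\chi_p(\{1\})=p$ and $\chi_p(\{0\})=\neg p$. For a $\sigma C^*$-algebra $\mathcal A$, an $\mathcal A$-valued POVM on $B$ is a map $\mu:B\to\mathcal A$ with $\mu(p)\ge 0$ for all $p$, $\mu(\top)=1$, and $\mu(\sup_n p_n)=\sum_n\mu(p_n)$ for every sequence of pairwise disjoint elements, where the sum is the supremum of the finite partial sums. It is a PVM if moreover $\mu(p\wedge q)=\mu(p)\mu(q)$ for all $p,q$. **Theorem.** Let $B$ be a Boolean σ-algebra and $\mathcal A$ a $\sigma C^*$-algebra. 1. For every POVM $\mu:B\to\mathcal A$ there is a unique σ-cpu map $\phi:\mathscr L^\infty_{\mathrm{abs}}(B)\to\mathcal A$ with $\phi(\chi_p)=\mu(p)$ for all $p\in B$, and every positive linear map $\psi$ with $\psi(\chi_p)=\mu(p)$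 for all $p$ equals $\phi$. Conversely, for every σ-cpu map $\phi$, the map $p\mapsto\phi(\chi_p)$ is a POVM. 2. For every PVM $\mu:B\to\mathcal A$ there is a unique σ-homomorphism $\phi:\mathscr L^\infty_{\mathrm{abs}}(B)\to\mathcal A$ with $\phi(\chi_p)=\mu(p)$ for all $p\in B$, and every positive linear map $\psi$ with $\psi(\chi_p)=\mu(p)$ for all $p$ equals $\phi$. Conversely, for every σ-homomorphism $\phi$, the map $p\mapsto\phi(\chi_p)$ is a PVM. -/

import Mathlib

open Set Filter Topology
open scoped CStarAlgebra

noncomputable section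

namespace PovmIntegration

universe u v w

/-! # Boolean σ-algebras and σ-homomorphisms -/

/-- A Boolean σ-algebra: a Boolean algebra with countable suprema and infima. -/
class IsBooleanSigmaAlgebra (B : Type u) [BooleanAlgebra B] : Prop where
  exists_isLUB : ∀ p : ℕ → B, ∃ s, IsLUB (range p) s
  exists_isGLB : ∀ p : ℕ → B, ∃ s, IsGLB (range p) s

/-- A σ-homomorphism of Boolean σ-algebras: a Boolean algebra homomorphism preserving suprema of
sequences. (A bounded lattice homomorphism between Boolean algebras preserves complements.) -/
structure SigmaHom (A : Type u) (B : Type v) [BooleanAlgebra A] [BooleanAlgebra B] extends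
    BoundedLatticeHom A B where
  map_isLUB' : ∀ (p : ℕ → A) (s : A), IsLUB (range p) s →
    IsLUB (range fun n => toFun (p n)) (toFun s)

/-- The Boolean σ-algebra of measurable sets of a measurable space. -/
abbrev MSet (Y : Type u) [MeasurableSpace Y] : Type u := Subtype (MeasurableSet : Set Y → Prop)

section SigmaHomBasics

variable {A : Type u} {B : Type v} {C : Type w} [BooleanAlgebra A] [BooleanAlgebra B]
  [BooleanAlgebra C] {Y Z : Type*} [MeasurableSpace Y] [MeasurableSpace Z]

instance : FunLike (SigmaHom A B) A B where
  coe f := f.toFun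
  coe_injective f g h := by
    obtain ⟨⟨⟨⟨f, _⟩, _⟩, _, _⟩, _⟩ := f
    obtain ⟨⟨⟨⟨g, _⟩, _⟩, _, _⟩, _⟩ := g
    congr

instance : BoundedLatticeHomClass (SigmaHom A B) A B where
  map_sup f := f.map_sup'
  map_inf f := f.map_inf'
  map_top f := f.map_top'
  map_bot f := f.map_bot'

theorem SigmaHom.map_isLUB (f : SigmaHom A B) {p : ℕ → A} {s : A} (h : IsLUB (range p) s) :
    IsLUB (range fun n => f (p n)) (f s) := f.map_isLUB' p s h

theorem isLUB_mset_iff (U : ℕ → MSet Y) (S : MSet Y) :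
    IsLUB (range U) S ↔ (S : Set Y) = ⋃ n, (U n : Set Y) := by
  have key : IsLUB (range U) (⟨⋃ n, (U n : Set Y), .iUnion fun n => (U n).2⟩ : MSet Y) := by
    refine ⟨?_, fun V hV => ?_⟩
    · rintro _ ⟨n, rfl⟩
      exact subset_iUnion (fun n => (U n : Set Y)) n
    · exact iUnion_subset fun n => hV ⟨n, rfl⟩
  constructor
  · intro h
    exact congrArg Subtype.val (h.unique key)
  · intro h
    have : S = ⟨⋃ n, (U n : Set Y), .iUnion fun n => (U n).2⟩ := Subtype.ext h
    rwa [this]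

theorem SigmaHom.map_empty (f : SigmaHom (MSet Y) B) (h : MeasurableSet (∅ : Set Y)) :
    f ⟨∅, h⟩ = ⊥ := f.map_bot'

theorem SigmaHom.map_univ (f : SigmaHom (MSet Y) B) (h : MeasurableSet (univ : Set Y)) :
    f ⟨univ, h⟩ = ⊤ := f.map_top'

instance : IsBooleanSigmaAlgebra (MSet Y) where
  exists_isLUB U := ⟨⟨⋃ n, (U n : Set Y), .iUnion fun n => (U n).2⟩, (isLUB_mset_iff _ _).2 rfl⟩
  exists_isGLB U := by
    refine ⟨⟨⋂ n, (U n : Set Y), .iInter fun n => (U n).2⟩, ?_, fun V hV => ?_⟩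
    · rintro _ ⟨n, rfl⟩
      exact iInter_subset (fun n => (U n : Set Y)) n
    · exact subset_iInter fun n => hV ⟨n, rfl⟩

/-- The composition `g ∘ f`. -/
def SigmaHom.comp (g : SigmaHom B C) (f : SigmaHom A B) : SigmaHom A C where
  toFun a := g (f a)
  map_sup' a b := by simp
  map_inf' a b := by simp
  map_top' := by simp
  map_bot' := by simp
  map_isLUB' _ _ h := g.map_isLUB (f.map_isLUB h)

/-- Taking preimages along a measurable map `g : Y → Z` is a σ-homomorphism. -/
def SigmaHom.preimage (g : Y → Z) (hg : Measurable g) : SigmaHom (MSet Z) (MSet Y) where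
  toFun U := ⟨g ⁻¹' U, hg U.2⟩
  map_sup' _ _ := rfl
  map_inf' _ _ := rfl
  map_top' := rfl
  map_bot' := rfl
  map_isLUB' U S h := by
    rw [isLUB_mset_iff] at h ⊢
    simp [h]

@[simp] theorem SigmaHom.comp_preimage_apply (f : SigmaHom (MSet Y) B) (g : Y → Z)
    (hg : Measurable g) (U : MSet Z) :
    f.comp (SigmaHom.preimage g hg) U = f ⟨g ⁻¹' U, hg U.2⟩ := rfl

open Classical in
/-- The σ-homomorphism `U ↦ (p if y ∈ U) ∨ (¬ p if z ∈ U)`. -/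
def SigmaHom.twoPoint (p : B) (y z : Y) : SigmaHom (MSet Y) B where
  toFun U := (if y ∈ (U : Set Y) then p else ⊥) ⊔ (if z ∈ (U : Set Y) then pᶜ else ⊥)
  map_sup' U V := by
    by_cases h1 : y ∈ (U : Set Y) <;> by_cases h2 : z ∈ (U : Set Y) <;>
    by_cases h3 : y ∈ (V : Set Y) <;> by_cases h4 : z ∈ (V : Set Y) <;>
    simp [h1, h2, h3, h4]
  map_inf' U V := by
    by_cases h1 : y ∈ (U : Set Y) <;> by_cases h2 : z ∈ (U : Set Y) <;>
    by_cases h3 : y ∈ (V : Set Y) <;> by_cases h4 : z ∈ (V : Set Y) <;>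
    simp [h1, h2, h3, h4]
  map_top' := by simp
  map_bot' := by simp
  map_isLUB' U S h := by
    rw [isLUB_mset_iff] at h
    have hle : ∀ n, (U n : Set Y) ⊆ S := fun n => h ▸ subset_iUnion (fun n => (U n : Set Y)) n
    refine ⟨?_, fun b hb => ?_⟩
    · rintro _ ⟨n, rfl⟩
      refine sup_le_sup ?_ ?_
      · by_cases h1 : y ∈ (U n : Set Y)
        · simp [h1, hle n h1]
        · simp [h1]
      · by_cases h1 : z ∈ (U n : Set Y)
        · simp [h1, hle n h1]
        · simp [h1]
    · refine sup_le ?_ ?_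
      · split_ifs with h1
        · rw [h, mem_iUnion] at h1
          obtain ⟨n, hn⟩ := h1
          refine le_trans ?_ (hb ⟨n, rfl⟩)
          simp [hn]
        · exact bot_le
      · split_ifs with h1
        · rw [h, mem_iUnion] at h1
          obtain ⟨n, hn⟩ := h1
          refine le_trans ?_ (hb ⟨n, rfl⟩)
          simp [hn]
        · exact bot_le

open Classical in
/-- The σ-homomorphism `U ↦ (⊤ if y ∈ U, ⊥ otherwise)`. -/
def SigmaHom.dirac (y : Y) : SigmaHom (MSet Y) B where
  toFun U := if y ∈ (U : Set Y) then ⊤ else ⊥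
  map_sup' U V := by
    by_cases h1 : y ∈ (U : Set Y) <;> by_cases h3 : y ∈ (V : Set Y) <;> simp [h1, h3]
  map_inf' U V := by
    by_cases h1 : y ∈ (U : Set Y) <;> by_cases h3 : y ∈ (V : Set Y) <;> simp [h1, h3]
  map_top' := by simp
  map_bot' := by simp
  map_isLUB' U S h := by
    have := (SigmaHom.twoPoint (⊤ : B) y y).map_isLUB' U S h
    simp only [SigmaHom.twoPoint, compl_top, ite_self, sup_bot_eq] at this
    exact this

end SigmaHomBasics

/-! # Loomis–Sikorski representation

Auxiliary facts, used to construct the pairing of two σ-homomorphisms and to check the axioms of a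
C⋆-algebra. -/

section LoomisSikorski

/-- The Stone space of a Boolean algebra. -/
def StoneSp (B : Type u) [BooleanAlgebra B] : Type u :=
  {x : B → Bool // x ⊤ = true ∧ x ⊥ = false ∧ (∀ a b, x (a ⊓ b) = (x a && x b)) ∧
    (∀ a b, x (a ⊔ b) = (x a || x b))}

variable {B : Type u} [BooleanAlgebra B]

instance : TopologicalSpace (StoneSp B) := instTopologicalSpaceSubtype

instance : T2Space (StoneSp B) := inferInstanceAs (T2Space (Subtype _))

instance : CompactSpace (StoneSp B) := by
  refine isCompact_iff_compactSpace.1 (IsClosed.isCompact ?_)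
  refine (isClosed_eq (by fun_prop) (by fun_prop)).and
    ((isClosed_eq (by fun_prop) (by fun_prop)).and (IsClosed.and ?_ ?_))
  · simp only [ofPred_forall]
    refine isClosed_iInter fun a => isClosed_iInter fun b => isClosed_eq (by fun_prop) ?_
    exact (continuous_of_discreteTopology (f := fun p : Bool × Bool => (p.1 && p.2))).comp
      (f := fun x : B → Bool => (x a, x b)) (by fun_prop)
  · simp only [ofPred_forall]
    refine isClosed_iInter fun a => isClosed_iInter fun b => isClosed_eq (by fun_prop) ?_
    exact (continuous_of_discreteTopology (f := fun p : Bool × Bool => (p.1 || p.2))).comp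
      (f := fun x : B → Bool => (x a, x b)) (by fun_prop)

/-- The clopen set of an element of the Boolean algebra. -/
def clop (b : B) : Set (StoneSp B) := {x | x.1 b = true}

theorem clop_top : clop (⊤ : B) = univ := eq_univ_of_forall fun x => x.2.1
theorem clop_bot : clop (⊥ : B) = ∅ := eq_empty_of_forall_notMem fun x hx => by
  simp [clop, x.2.2.1] at hx
theorem clop_inf (a b : B) : clop (a ⊓ b) = clop a ∩ clop b := by
  ext x; simp [clop, x.2.2.2.1]
theorem clop_sup (a b : B) : clop (a ⊔ b) = clop a ∪ clop b := by
  ext x; simp [clop, x.2.2.2.2]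
theorem clop_compl (a : B) : clop aᶜ = (clop a)ᶜ := by
  refine (IsCompl.compl_eq ⟨?_, ?_⟩).symm
  · refine disjoint_iff.2 ((clop_inf a aᶜ).symm.trans ?_)
    rw [inf_compl_eq_bot, clop_bot]; rfl
  · refine codisjoint_iff.2 ((clop_sup a aᶜ).symm.trans ?_)
    rw [sup_compl_eq_top, clop_top]; rfl
theorem clop_mono {a b : B} (h : a ≤ b) : clop a ⊆ clop b := by
  rw [← inf_eq_left.2 h, clop_inf]; exact inter_subset_right

theorem isClopen_clop (b : B) : IsClopen (clop b) := by
  have hc : Continuous fun x : StoneSp B => x.1 b := (continuous_apply b).comp continuous_subtype_val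
  exact (isClopen_discrete {true}).preimage hc

theorem clop_nonempty {b : B} (hb : b ≠ ⊥) : (clop b).Nonempty := by
  obtain ⟨J, hJ, -, hd⟩ := DistribLattice.prime_ideal_of_disjoint_filter_ideal
    (F := Order.PFilter.principal b) (I := Order.Ideal.principal (⊥ : B)) (by
      rw [Set.disjoint_left]
      intro x hx hx'
      simp only [SetLike.mem_coe, Order.PFilter.mem_principal, Order.Ideal.mem_principal] at hx hx'
      exact hb (le_bot_iff.1 (hx.trans hx')))
  classical
  have hbJ : b ∉ J := fun h => Set.disjoint_left.1 hd (by simp) h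
  refine ⟨⟨fun c => decide (c ∉ J), ?_, ?_, ?_, ?_⟩, ?_⟩
  · simpa using fun h => hbJ (J.lower le_top h)
  · simp
  · intro x y
    have : x ⊓ y ∈ J ↔ x ∈ J ∨ y ∈ J :=
      ⟨fun h => hJ.mem_or_mem h, fun h => h.elim (J.lower inf_le_left) (J.lower inf_le_right)⟩
    simp only [this, not_or, Bool.decide_and]
  · intro x y
    have : x ⊔ y ∈ J ↔ x ∈ J ∧ y ∈ J := Order.Ideal.sup_mem_iff
    simp only [this, not_and_or, Bool.decide_or]
  · exact decide_eq_true hbJ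

/-- Every nonempty open set contains a nonempty clopen set of the form `clop b`. -/
theorem exists_clop_subset {O : Set (StoneSp B)} (hO : IsOpen O) {x : StoneSp B} (hx : x ∈ O) :
    ∃ b, x ∈ clop b ∧ clop b ⊆ O := by
  obtain ⟨O', hO', rfl⟩ := isOpen_induced_iff.1 hO
  obtain ⟨I, t, ht, hsub⟩ := isOpen_pi_iff.1 hO' x.1 hx
  have key : ∀ I : Finset B, ∃ b, x ∈ clop b ∧ ∀ y ∈ clop b, ∀ i ∈ I, y.1 i = x.1 i := by
    classical
    intro I
    induction I using Finset.induction_on with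
    | empty => exact ⟨⊤, by simp [clop_top], by simp⟩
    | insert i I _ ih =>
      obtain ⟨b, hb, hby⟩ := ih
      cases hxi : x.1 i with
      | true =>
        refine ⟨b ⊓ i, by rw [clop_inf]; exact ⟨hb, hxi⟩, fun y hy j hj => ?_⟩
        rw [clop_inf] at hy
        rcases Finset.mem_insert.1 hj with rfl | hj
        · rw [hxi]; exact hy.2
        · exact hby y hy.1 j hj
      | false =>
        refine ⟨b ⊓ iᶜ, by rw [clop_inf, clop_compl]; exact ⟨hb, by simp [clop, hxi]⟩,
          fun y hy j hj => ?_⟩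
        rw [clop_inf, clop_compl] at hy
        rcases Finset.mem_insert.1 hj with rfl | hj
        · rw [hxi]; simpa [clop] using hy.2
        · exact hby y hy.1 j hj
  obtain ⟨b, hb, hby⟩ := key I
  refine ⟨b, hb, fun y hy => hsub fun i hi => ?_⟩
  rw [hby y hy i hi]
  exact (ht i hi).2

theorem le_of_clop_eventuallyLE {a b : B} (h : clop a ≤ᶠ[residual _] clop b) : a ≤ b := by
  by_contra hab
  have hne : a ⊓ bᶜ ≠ ⊥ := fun h0 => hab <| by
    rwa [← disjoint_iff, disjoint_compl_right_iff] at h0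
  obtain ⟨x, hx, hx'⟩ := (dense_of_mem_residual h).inter_open_nonempty _
    (isClopen_clop (a ⊓ bᶜ)).isOpen (clop_nonempty hne)
  rw [clop_inf, clop_compl] at hx
  exact hx.2 (hx' hx.1)

theorem eq_of_clop_eventuallyEq {a b : B} (h : clop a =ᶠ[residual _] clop b) : a = b :=
  le_antisymm (le_of_clop_eventuallyLE h.le) (le_of_clop_eventuallyLE h.symm.le)

theorem clop_isLUB {p : ℕ → B} {s : B} (h : IsLUB (range p) s) :
    clop s =ᶠ[residual _] ⋃ n, clop (p n) := by
  refine Filter.EventuallyLE.antisymm ?_ (LE.le.eventuallyLE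
    (iUnion_subset fun n => clop_mono (h.1 ⟨n, rfl⟩)))
  have hopen : IsOpen ((clop s)ᶜ ∪ ⋃ n, clop (p n)) :=
    (isClopen_clop s).compl.isOpen.union (isOpen_iUnion fun n => (isClopen_clop (p n)).isOpen)
  have hdense : Dense ((clop s)ᶜ ∪ ⋃ n, clop (p n)) := by
    rw [dense_iff_inter_open]
    rintro O hO ⟨x, hx⟩
    obtain ⟨c, hxc, hc⟩ := exists_clop_subset hO hx
    by_contra hcon
    rw [not_nonempty_iff_eq_empty] at hcon
    have hcs : clop c ⊆ clop s := fun y hy => by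
      by_contra hys
      exact (hcon ▸ (⟨hc hy, Or.inl hys⟩ : y ∈ O ∩ _) : y ∈ (∅ : Set _))
    have hcp : ∀ n, p n ≤ s ⊓ cᶜ := fun n => le_inf (h.1 ⟨n, rfl⟩) (by
      refine le_of_clop_eventuallyLE (LE.le.eventuallyLE fun y hy => ?_)
      rw [clop_compl]
      intro hyc
      exact (hcon ▸ (⟨hc hyc, Or.inr (mem_iUnion.2 ⟨n, hy⟩)⟩ : y ∈ O ∩ _) : y ∈ (∅ : Set _)))
    have hs : s ≤ s ⊓ cᶜ := h.2 (by rintro _ ⟨n, rfl⟩; exact hcp n)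
    have := clop_mono hs (hcs hxc)
    rw [clop_inf, clop_compl] at this
    exact this.2 hxc
  filter_upwards [residual_of_dense_open hopen hdense] with x hx hxs
  exact hx.resolve_left fun h => h hxs

theorem clop_iUnion_of_isLUB {S : ℕ → Set (StoneSp B)} {p : ℕ → B} {s : B}
    (h : IsLUB (range p) s) (hS : ∀ n, S n =ᶠ[residual _] clop (p n)) :
    (⋃ n, S n) =ᶠ[residual _] clop s :=
  (Filter.EventuallyEq.countable_iUnion hS).trans (clop_isLUB h).symm

variable {Y Z : Type*} [MeasurableSpace Y] [MeasurableSpace Z]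

/-- The point map `F` on the Stone space represents the σ-homomorphism `f`. -/
def Reps (F : StoneSp B → Y) (f : SigmaHom (MSet Y) B) : Prop :=
  ∀ U : MSet Y, F ⁻¹' U =ᶠ[residual _] clop (f U)

theorem Reps.unique {F G : StoneSp B → Y} {f g : SigmaHom (MSet Y) B} (hF : Reps F f)
    (hG : Reps G g) (h : F =ᶠ[residual _] G) : f = g := by
  refine DFunLike.ext _ _ fun U => eq_of_clop_eventuallyEq ((hF U).symm.trans (.trans ?_ (hG U)))
  exact h.preimage U

theorem Reps.congr {F G : StoneSp B → Y} {f : SigmaHom (MSet Y) B} (hF : Reps F f)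
    (h : G =ᶠ[residual _] F) : Reps G f := fun U => (h.preimage U).trans (hF U)

theorem Reps.comp {F : StoneSp B → Y} {f : SigmaHom (MSet Y) B} (h : Reps F f) {g : Y → Z}
    (hg : Measurable g) : Reps (g ∘ F) (f.comp (SigmaHom.preimage g hg)) :=
  fun U => h ⟨g ⁻¹' U, hg U.2⟩

/-- To represent `f` it suffices to represent it on a generating family. -/
theorem Reps.of_generate {s : Set (Set Y)} (hs : ‹MeasurableSpace Y› = MeasurableSpace.generateFrom s)
    {F : StoneSp B → Y} {f : SigmaHom (MSet Y) B}
    (h : ∀ U : MSet Y, (U : Set Y) ∈ s → F ⁻¹' U =ᶠ[residual _] clop (f U)) : Reps F f := by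
  have key : ∀ U : Set Y, @MeasurableSet _ (MeasurableSpace.generateFrom s) U →
      ∀ hU : MeasurableSet U, F ⁻¹' U =ᶠ[residual _] clop (f ⟨U, hU⟩) := by
    intro U hU
    induction U, hU using MeasurableSpace.generateFrom_induction with
    | hC t ht _ => exact fun h' => h ⟨t, h'⟩ ht
    | empty =>
      intro h'
      rw [f.map_empty h', clop_bot, preimage_empty]
      rfl
    | compl t _ ih =>
      intro h'
      have : (⟨tᶜ, h'⟩ : MSet Y) = (⟨t, by simpa using h'.compl⟩ : MSet Y)ᶜ := rfl
      rw [this, map_compl', clop_compl, preimage_compl]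
      exact (ih _).compl
    | iUnion t ht ih =>
      intro h'
      have ht' : ∀ n, MeasurableSet (t n) := fun n => by rw [hs]; exact ht n
      rw [preimage_iUnion]
      exact clop_iUnion_of_isLUB (f.map_isLUB
        ((isLUB_mset_iff (fun n => ⟨t n, ht' n⟩) ⟨_, h'⟩).2 rfl)) fun n => ih n (ht' n)
  exact fun U => key U (by rw [← hs]; exact U.2) U.2

variable [IsBooleanSigmaAlgebra B]

/-- The σ-algebra of all sets that agree with a clopen set up to a meagre set. -/
instance : MeasurableSpace (StoneSp B) where
  MeasurableSet' S := ∃ b, S =ᶠ[residual _] clop b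
  measurableSet_empty := ⟨⊥, by rw [clop_bot]; rfl⟩
  measurableSet_compl := by
    rintro S ⟨b, hb⟩
    exact ⟨bᶜ, by rw [clop_compl]; exact hb.compl⟩
  measurableSet_iUnion := by
    intro S hS
    choose p hp using hS
    obtain ⟨s, hs⟩ := IsBooleanSigmaAlgebra.exists_isLUB p
    exact ⟨s, clop_iUnion_of_isLUB hs hp⟩

theorem measurableSet_stone {S : Set (StoneSp B)} :
    MeasurableSet S ↔ ∃ b, S =ᶠ[residual _] clop b := Iff.rfl

theorem measurableSet_of_ae {S T : Set (StoneSp B)} (h : S =ᶠ[residual _] T)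
    (hT : MeasurableSet T) : MeasurableSet S := by
  obtain ⟨b, hb⟩ := measurableSet_stone.1 hT
  exact ⟨b, h.trans hb⟩

/-- The element of the Boolean algebra represented by a measurable set of the Stone space. -/
def stoneClass (S : MSet (StoneSp B)) : B := (measurableSet_stone.1 S.2).choose

theorem stoneClass_spec (S : MSet (StoneSp B)) :
    (S : Set (StoneSp B)) =ᶠ[residual _] clop (stoneClass S) :=
  (measurableSet_stone.1 S.2).choose_spec

theorem stoneClass_eq {S : MSet (StoneSp B)} {b : B}
    (h : (S : Set (StoneSp B)) =ᶠ[residual _] clop b) : stoneClass S = b :=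
  eq_of_clop_eventuallyEq ((stoneClass_spec S).symm.trans h)

/-- The Loomis–Sikorski quotient map. -/
def stoneHom : SigmaHom (MSet (StoneSp B)) B where
  toFun := stoneClass
  map_sup' S T := stoneClass_eq (by
    rw [clop_sup]; exact (stoneClass_spec S).union (stoneClass_spec T))
  map_inf' S T := stoneClass_eq (by
    rw [clop_inf]; exact (stoneClass_spec S).inter (stoneClass_spec T))
  map_top' := stoneClass_eq (by rw [clop_top]; rfl)
  map_bot' := stoneClass_eq (by rw [clop_bot]; rfl)
  map_isLUB' S T h := by
    obtain ⟨s, hs⟩ := IsBooleanSigmaAlgebra.exists_isLUB fun n => stoneClass (S n)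
    have : stoneClass T = s := stoneClass_eq (by
      rw [(isLUB_mset_iff _ _).1 h]
      exact clop_iUnion_of_isLUB hs fun n => stoneClass_spec (S n))
    rw [this]; exact hs

theorem Reps.measurable {F : StoneSp B → Y} {f : SigmaHom (MSet Y) B} (h : Reps F f) :
    Measurable F := fun U hU => ⟨_, h ⟨U, hU⟩⟩

theorem exists_of_measurable {F : StoneSp B → Y} (hF : Measurable F) :
    ∃ f : SigmaHom (MSet Y) B, Reps F f :=
  ⟨stoneHom.comp (SigmaHom.preimage F hF), fun U => stoneClass_spec ⟨F ⁻¹' U, hF U.2⟩⟩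

theorem exists_reps [StandardBorelSpace Y] [Nonempty Y] (f : SigmaHom (MSet Y) B) :
    ∃ F : StoneSp B → Y, Reps F f := by
  set e : Y → ℕ → Bool := MeasurableSpace.mapNatBool Y with he
  have hem : Measurable e := MeasurableSpace.measurable_mapNatBool Y
  have hemb : MeasurableEmbedding e :=
    hem.measurableEmbedding (MeasurableSpace.injective_mapNatBool Y)
  let T : ℕ → Set (ℕ → Bool) := fun n => {t | t n = true}
  have hT : ∀ n, MeasurableSet (T n) := fun n =>
    measurableSet_eq_fun (measurable_pi_apply n) measurable_const
  let f' : SigmaHom (MSet (ℕ → Bool)) B := f.comp (SigmaHom.preimage e hem)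
  classical
  let G : StoneSp B → ℕ → Bool := fun x n => decide (x ∈ clop (f' ⟨T n, hT n⟩))
  have hgen : (inferInstance : MeasurableSpace (ℕ → Bool)) =
      MeasurableSpace.generateFrom (range T) := by
    refine le_antisymm ?_ (MeasurableSpace.generateFrom_le (by rintro _ ⟨n, rfl⟩; exact hT n))
    refine iSup_le fun n => ?_
    rw [← measurable_iff_comap_le]
    refine @measurable_to_bool _ (MeasurableSpace.generateFrom (range T)) _ ?_
    exact MeasurableSpace.measurableSet_generateFrom ⟨n, rfl⟩
  have hG : Reps G f' := Reps.of_generate hgen (by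
    rintro ⟨_, h⟩ ⟨n, rfl⟩
    refine EventuallyEq.of_eq ?_
    ext x
    simp [G, T])
  refine ⟨Function.invFun e ∘ G, fun U => ?_⟩
  have hr : ∀ᶠ x in residual (StoneSp B), G x ∈ range e := by
    have := hG ⟨range e, hemb.measurableSet_range⟩
    have h1 : f' ⟨range e, hemb.measurableSet_range⟩ = ⊤ := by
      have : (⟨e ⁻¹' range e, hem hemb.measurableSet_range⟩ : MSet Y) = ⟨univ, .univ⟩ :=
        Subtype.ext (preimage_range e)
      simp only [f', SigmaHom.comp_preimage_apply, this, f.map_univ]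
    rw [h1, clop_top] at this
    filter_upwards [this] with x hx
    exact (hx.mpr trivial : x ∈ G ⁻¹' range e)
  have hU := hG ⟨e '' U, hemb.measurableSet_image.2 U.2⟩
  have h2 : f' ⟨e '' U, hemb.measurableSet_image.2 U.2⟩ = f U := by
    have : (⟨e ⁻¹' (e '' U), hem (hemb.measurableSet_image.2 U.2)⟩ : MSet Y) = U :=
      Subtype.ext (preimage_image_eq _ hemb.injective)
    simp only [f', SigmaHom.comp_preimage_apply, this]
  rw [h2] at hU
  refine EventuallyEq.trans ?_ hU
  filter_upwards [hr] with x ⟨y, hy⟩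
  refine propext ?_
  change Function.invFun e (G x) ∈ (U : Set Y) ↔ G x ∈ e '' U
  rw [← hy, Function.leftInverse_invFun hemb.injective y]
  exact (hemb.injective.mem_set_image).symm

/-- The pairing of two σ-homomorphisms exists and is unique. -/
theorem existsUnique_pair (f g : SigmaHom (MSet ℂ) B) :
    ∃! T : SigmaHom (MSet (ℂ × ℂ)) B, ∀ U V : MSet ℂ, T ⟨U ×ˢ V, U.2.prod V.2⟩ = f U ⊓ g V := by
  obtain ⟨F, hF⟩ := exists_reps f
  obtain ⟨G, hG⟩ := exists_reps g
  obtain ⟨T, hT⟩ := exists_of_measurable (hF.measurable.prodMk hG.measurable)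
  refine ⟨T, fun U V => ?_, fun T' hT' => ?_⟩
  · refine eq_of_clop_eventuallyEq ((hT _).symm.trans ?_)
    rw [clop_inf]
    exact (hF U).inter (hG V)
  · refine Reps.unique (F := fun x => (F x, G x)) (Reps.of_generate generateFrom_prod.symm ?_)
      hT .rfl
    rintro ⟨_, h⟩ ⟨U, hU, V, hV, rfl⟩
    rw [hT' ⟨U, hU⟩ ⟨V, hV⟩, clop_inf]
    exact (hF ⟨U, hU⟩).inter (hG ⟨V, hV⟩)

end LoomisSikorski

/-! # The algebra of bounded abstract measurable functions -/

/-- The elements of `L^∞_abs(B)`: σ-homomorphisms `f` from the Borel sets of `ℂ` to `B` such that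
`f U = ⊤` for some bounded Borel set `U`. -/
@[ext] structure Linf (B : Type u) [BooleanAlgebra B] where
  hom : SigmaHom (MSet ℂ) B
  exists_bounded : ∃ U : MSet ℂ, Bornology.IsBounded (U : Set ℂ) ∧ hom U = ⊤

namespace Linf

section Operations

variable {B : Type u} [BooleanAlgebra B]

/-- The closed ball around `0`, as a Borel set. -/
def cball (r : ℝ) : MSet ℂ := ⟨Metric.closedBall 0 r, measurableSet_closedBall⟩

theorem exists_cball (f : Linf B) : ∃ r : ℝ, 0 ≤ r ∧ f.hom (cball r) = ⊤ := by
  obtain ⟨U, hU, hf⟩ := f.exists_bounded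
  obtain ⟨r, hr⟩ := hU.subset_closedBall 0
  refine ⟨max r 0, le_max_right _ _, top_unique ?_⟩
  rw [← hf]
  exact OrderHomClass.mono f.hom
    (hr.trans (Metric.closedBall_subset_closedBall (le_max_left _ _)) : (U : Set ℂ) ⊆ _)

/-- The characteristic function `χ_p`, the σ-homomorphism with `χ_p {1} = p`
and `χ_p {0} = ¬ p`. -/
def chi (p : B) : Linf B where
  hom := SigmaHom.twoPoint p 1 0
  exists_bounded := by
    refine ⟨cball 1, Metric.isBounded_closedBall, ?_⟩
    simp [SigmaHom.twoPoint, cball, DFunLike.coe]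

theorem chi_singleton_one (p : B) : (chi p).hom ⟨{1}, measurableSet_singleton 1⟩ = p := by
  simp [chi, SigmaHom.twoPoint, DFunLike.coe]

theorem chi_singleton_zero (p : B) : (chi p).hom ⟨{0}, measurableSet_singleton 0⟩ = pᶜ := by
  simp [chi, SigmaHom.twoPoint, DFunLike.coe]

/-- The constant function with value `c`. -/
def const (c : ℂ) : Linf B where
  hom := SigmaHom.dirac c
  exists_bounded := ⟨⟨{c}, measurableSet_singleton c⟩, Bornology.isBounded_singleton, by
    simp [SigmaHom.dirac, DFunLike.coe]⟩

/-- The composite of `f` with a continuous function `op : ℂ → ℂ`, given by `U ↦ f (op ⁻¹ U)`. -/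
def map₁ (op : ℂ → ℂ) (hop : Continuous op) (f : Linf B) : Linf B where
  hom := f.hom.comp (SigmaHom.preimage op hop.measurable)
  exists_bounded := by
    obtain ⟨r, -, hr⟩ := f.exists_cball
    have hc : IsCompact (op '' Metric.closedBall 0 r) :=
      (isCompact_closedBall 0 r).image hop
    refine ⟨⟨_, hc.measurableSet⟩, hc.isBounded, top_unique ?_⟩
    rw [← hr]
    refine OrderHomClass.mono f.hom ?_
    exact subset_preimage_image op (Metric.closedBall 0 r)

/-- The norm `‖f‖ = inf {r ≥ 0 | f (closed ball of radius r around 0) = ⊤}`. -/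
instance : Norm (Linf B) where
  norm f := sInf {r : ℝ | 0 ≤ r ∧ f.hom (cball r) = ⊤}

instance : Zero (Linf B) := ⟨const 0⟩
instance : One (Linf B) := ⟨const 1⟩
instance : Neg (Linf B) := ⟨map₁ (fun z => -z) continuous_neg⟩
/-- For `c ≠ 0` this is `(c • f) U = f (c⁻¹ U)`. -/
instance : SMul ℂ (Linf B) := ⟨fun c => map₁ (fun z => c * z) (continuous_const_mul c)⟩
instance : Star (Linf B) := ⟨map₁ (fun z => star z) continuous_star⟩

variable [IsBooleanSigmaAlgebra B]

/-- The pairing `⟨f, g⟩` of `f` and `g`: the unique σ-homomorphism from the Borel sets of `ℂ × ℂ`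
with `⟨f, g⟩ (U × V) = f U ∧ g V`. -/
def pair (f g : Linf B) : SigmaHom (MSet (ℂ × ℂ)) B := (existsUnique_pair f.hom g.hom).choose

theorem pair_prod (f g : Linf B) (U V : MSet ℂ) :
    pair f g ⟨U ×ˢ V, U.2.prod V.2⟩ = f.hom U ⊓ g.hom V :=
  (existsUnique_pair f.hom g.hom).choose_spec.1 U V

/-- The σ-homomorphism `U ↦ ⟨f, g⟩ (op ⁻¹ U)`, for a continuous function `op : ℂ × ℂ → ℂ`. -/
def map₂ (op : ℂ × ℂ → ℂ) (hop : Continuous op) (f g : Linf B) : Linf B where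
  hom := (pair f g).comp (SigmaHom.preimage op hop.measurable)
  exists_bounded := by
    obtain ⟨r, -, hr⟩ := f.exists_cball
    obtain ⟨s, -, hs⟩ := g.exists_cball
    have hc : IsCompact (op '' (Metric.closedBall 0 r ×ˢ Metric.closedBall 0 s)) :=
      ((isCompact_closedBall 0 r).prod (isCompact_closedBall 0 s)).image hop
    refine ⟨⟨_, hc.measurableSet⟩, hc.isBounded, top_unique ?_⟩
    have h := pair_prod f g (cball r) (cball s)
    rw [hr, hs, top_inf_eq] at h
    rw [← h]
    refine OrderHomClass.mono (pair f g) ?_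
    exact subset_preimage_image op (Metric.closedBall 0 r ×ˢ Metric.closedBall 0 s)

instance : Add (Linf B) := ⟨map₂ (fun z => z.1 + z.2) continuous_add⟩
instance : Mul (Linf B) := ⟨map₂ (fun z => z.1 * z.2) continuous_mul⟩

end Operations

/-! Verification of the axioms of a commutative C⋆-algebra. -/

section Axioms

variable {B : Type u} [BooleanAlgebra B]

theorem reps_const (c : ℂ) : Reps (fun _ => c) (const c : Linf B).hom := by
  intro U
  refine EventuallyEq.of_eq ?_
  by_cases h : c ∈ (U : Set ℂ)
  · have : (const c : Linf B).hom U = ⊤ := by simp [const, SigmaHom.dirac, DFunLike.coe, h]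
    rw [this, clop_top]
    exact eq_univ_of_forall fun _ => h
  · have : (const c : Linf B).hom U = ⊥ := by simp [const, SigmaHom.dirac, DFunLike.coe, h]
    rw [this, clop_bot]
    exact eq_empty_of_forall_notMem fun _ => h

theorem reps_map₁ {op : ℂ → ℂ} (hop : Continuous op) {F : StoneSp B → ℂ} {f : Linf B}
    (hF : Reps F f.hom) : Reps (fun x => op (F x)) (map₁ op hop f).hom :=
  hF.comp hop.measurable

theorem hom_eq_top_iff {F : StoneSp B → ℂ} {f : Linf B} (hF : Reps F f.hom) (U : MSet ℂ) :
    f.hom U = ⊤ ↔ ∀ᶠ x in residual (StoneSp B), F x ∈ (U : Set ℂ) := by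
  constructor
  · intro h
    have := hF U
    rw [h, clop_top] at this
    filter_upwards [this] with x hx
    exact (hx.mpr trivial : x ∈ F ⁻¹' U)
  · intro h
    refine eq_of_clop_eventuallyEq ((hF U).symm.trans ?_)
    rw [clop_top]
    filter_upwards [h] with x hx
    exact eq_true hx

theorem eq_of_reps {F G : StoneSp B → ℂ} {f g : Linf B} (hF : Reps F f.hom) (hG : Reps G g.hom)
    (h : ∀ x, F x = G x) : f = g :=
  Linf.ext (hF.unique hG (Eventually.of_forall h))

theorem reps_zero : Reps (fun _ => 0) (0 : Linf B).hom := reps_const 0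
theorem reps_one : Reps (fun _ => 1) (1 : Linf B).hom := reps_const 1

theorem reps_neg {F : StoneSp B → ℂ} {f : Linf B} (hF : Reps F f.hom) :
    Reps (fun x => -F x) (-f).hom := reps_map₁ continuous_neg hF

theorem reps_smul {F : StoneSp B → ℂ} {f : Linf B} (hF : Reps F f.hom) (c : ℂ) :
    Reps (fun x => c * F x) (c • f).hom := reps_map₁ (continuous_const_mul c) hF

theorem reps_star {F : StoneSp B → ℂ} {f : Linf B} (hF : Reps F f.hom) :
    Reps (fun x => star (F x)) (star f).hom := reps_map₁ continuous_star hF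

theorem bddBelow_norm (f : Linf B) : BddBelow {r : ℝ | 0 ≤ r ∧ f.hom (cball r) = ⊤} :=
  ⟨0, fun _ h => h.1⟩

theorem norm_nonneg' (f : Linf B) : 0 ≤ ‖f‖ := Real.sInf_nonneg fun _ h => h.1

theorem norm_le_iff {F : StoneSp B → ℂ} {f : Linf B} (hF : Reps F f.hom) {r : ℝ} (hr : 0 ≤ r) :
    ‖f‖ ≤ r ↔ ∀ᶠ x in residual (StoneSp B), ‖F x‖ ≤ r := by
  have key : ∀ s : ℝ, f.hom (cball s) = ⊤ ↔ ∀ᶠ x in residual (StoneSp B), ‖F x‖ ≤ s := fun s => by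
    rw [hom_eq_top_iff hF]; simp [cball]
  constructor
  · intro h
    have : ∀ n : ℕ, ∀ᶠ x in residual (StoneSp B), ‖F x‖ ≤ r + 1 / ((n : ℝ) + 1) := fun n => by
      obtain ⟨s, hs, hlt⟩ := exists_lt_of_csInf_lt
        (s := {r : ℝ | 0 ≤ r ∧ f.hom (cball r) = ⊤}) f.exists_cball
        (lt_of_le_of_lt h (lt_add_of_pos_right r (by positivity : (0 : ℝ) < 1 / ((n : ℝ) + 1))))
      filter_upwards [(key s).1 hs.2] with x hx using hx.trans hlt.le
    filter_upwards [eventually_countable_forall.2 this] with x hx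
    refine ge_of_tendsto' (x := atTop) (f := fun n : ℕ => r + 1 / ((n : ℝ) + 1)) ?_ hx
    simpa using tendsto_const_nhds.add (tendsto_one_div_add_atTop_nhds_zero_nat (𝕜 := ℝ))
  · intro h
    exact csInf_le (bddBelow_norm f) ⟨hr, (key r).2 h⟩

theorem ae_norm_le {F : StoneSp B → ℂ} {f : Linf B} (hF : Reps F f.hom) :
    ∀ᶠ x in residual (StoneSp B), ‖F x‖ ≤ ‖f‖ := (norm_le_iff hF (norm_nonneg' f)).1 le_rfl

variable [IsBooleanSigmaAlgebra B]

theorem reps_pair {F G : StoneSp B → ℂ} {f g : Linf B} (hF : Reps F f.hom) (hG : Reps G g.hom) :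
    Reps (fun x => (F x, G x)) (pair f g) := by
  refine Reps.of_generate generateFrom_prod.symm ?_
  rintro ⟨_, h⟩ ⟨U, hU, V, hV, rfl⟩
  rw [pair_prod f g ⟨U, hU⟩ ⟨V, hV⟩, clop_inf]
  exact (hF ⟨U, hU⟩).inter (hG ⟨V, hV⟩)

theorem reps_map₂ {op : ℂ × ℂ → ℂ} (hop : Continuous op) {F G : StoneSp B → ℂ} {f g : Linf B}
    (hF : Reps F f.hom) (hG : Reps G g.hom) :
    Reps (fun x => op (F x, G x)) (map₂ op hop f g).hom :=
  (reps_pair hF hG).comp hop.measurable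

theorem exists_rep (f : Linf B) : ∃ F : StoneSp B → ℂ, Reps F f.hom := exists_reps f.hom

theorem reps_add {F G : StoneSp B → ℂ} {f g : Linf B} (hF : Reps F f.hom)
    (hG : Reps G g.hom) :
    Reps (fun x => F x + G x) (f + g).hom := reps_map₂ continuous_add hF hG

theorem reps_mul {F G : StoneSp B → ℂ} {f g : Linf B} (hF : Reps F f.hom)
    (hG : Reps G g.hom) :
    Reps (fun x => F x * G x) (f * g).hom := reps_map₂ continuous_mul hF hG

instance : CommRing (Linf B) where
  add_assoc f g h := by
    obtain ⟨F, hF⟩ := f.exists_rep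
    obtain ⟨G, hG⟩ := g.exists_rep
    obtain ⟨H, hH⟩ := h.exists_rep
    exact eq_of_reps (reps_add (reps_add hF hG) hH) (reps_add hF (reps_add hG hH))
      fun x => add_assoc _ _ _
  zero_add f := by
    obtain ⟨F, hF⟩ := f.exists_rep
    exact eq_of_reps (reps_add reps_zero hF) hF fun x => zero_add _
  add_zero f := by
    obtain ⟨F, hF⟩ := f.exists_rep
    exact eq_of_reps (reps_add hF reps_zero) hF fun x => add_zero _
  add_comm f g := by
    obtain ⟨F, hF⟩ := f.exists_rep
    obtain ⟨G, hG⟩ := g.exists_rep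
    exact eq_of_reps (reps_add hF hG) (reps_add hG hF) fun x => add_comm _ _
  left_distrib f g h := by
    obtain ⟨F, hF⟩ := f.exists_rep
    obtain ⟨G, hG⟩ := g.exists_rep
    obtain ⟨H, hH⟩ := h.exists_rep
    exact eq_of_reps (reps_mul hF (reps_add hG hH)) (reps_add (reps_mul hF hG) (reps_mul hF hH))
      fun x => mul_add _ _ _
  right_distrib f g h := by
    obtain ⟨F, hF⟩ := f.exists_rep
    obtain ⟨G, hG⟩ := g.exists_rep
    obtain ⟨H, hH⟩ := h.exists_rep
    exact eq_of_reps (reps_mul (reps_add hF hG) hH) (reps_add (reps_mul hF hH) (reps_mul hG hH))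
      fun x => add_mul _ _ _
  zero_mul f := by
    obtain ⟨F, hF⟩ := f.exists_rep
    exact eq_of_reps (reps_mul reps_zero hF) reps_zero fun x => zero_mul _
  mul_zero f := by
    obtain ⟨F, hF⟩ := f.exists_rep
    exact eq_of_reps (reps_mul hF reps_zero) reps_zero fun x => mul_zero _
  mul_assoc f g h := by
    obtain ⟨F, hF⟩ := f.exists_rep
    obtain ⟨G, hG⟩ := g.exists_rep
    obtain ⟨H, hH⟩ := h.exists_rep
    exact eq_of_reps (reps_mul (reps_mul hF hG) hH) (reps_mul hF (reps_mul hG hH))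
      fun x => mul_assoc _ _ _
  one_mul f := by
    obtain ⟨F, hF⟩ := f.exists_rep
    exact eq_of_reps (reps_mul reps_one hF) hF fun x => one_mul _
  mul_one f := by
    obtain ⟨F, hF⟩ := f.exists_rep
    exact eq_of_reps (reps_mul hF reps_one) hF fun x => mul_one _
  mul_comm f g := by
    obtain ⟨F, hF⟩ := f.exists_rep
    obtain ⟨G, hG⟩ := g.exists_rep
    exact eq_of_reps (reps_mul hF hG) (reps_mul hG hF) fun x => mul_comm _ _
  neg_add_cancel f := by
    obtain ⟨F, hF⟩ := f.exists_rep
    exact eq_of_reps (reps_add (reps_neg hF) hF) reps_zero fun x => neg_add_cancel _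
  nsmul := nsmulRec
  zsmul := zsmulRec

instance : Module ℂ (Linf B) where
  one_smul f := by
    obtain ⟨F, hF⟩ := f.exists_rep
    exact eq_of_reps (reps_smul hF 1) hF fun x => one_mul _
  mul_smul a b f := by
    obtain ⟨F, hF⟩ := f.exists_rep
    exact eq_of_reps (reps_smul hF (a * b)) (reps_smul (reps_smul hF b) a) fun x => mul_assoc _ _ _
  smul_zero a := eq_of_reps (reps_smul reps_zero a) reps_zero fun x => mul_zero _
  smul_add a f g := by
    obtain ⟨F, hF⟩ := f.exists_rep
    obtain ⟨G, hG⟩ := g.exists_rep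
    exact eq_of_reps (reps_smul (reps_add hF hG) a) (reps_add (reps_smul hF a) (reps_smul hG a))
      fun x => mul_add _ _ _
  add_smul a b f := by
    obtain ⟨F, hF⟩ := f.exists_rep
    exact eq_of_reps (reps_smul hF (a + b)) (reps_add (reps_smul hF a) (reps_smul hF b))
      fun x => add_mul _ _ _
  zero_smul f := by
    obtain ⟨F, hF⟩ := f.exists_rep
    exact eq_of_reps (reps_smul hF 0) reps_zero fun x => zero_mul _

instance : Algebra ℂ (Linf B) :=
  Algebra.ofModule
    (fun a f g => by
      obtain ⟨F, hF⟩ := f.exists_rep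
      obtain ⟨G, hG⟩ := g.exists_rep
      exact eq_of_reps (reps_mul (reps_smul hF a) hG) (reps_smul (reps_mul hF hG) a)
        fun x => mul_assoc _ _ _)
    (fun a f g => by
      obtain ⟨F, hF⟩ := f.exists_rep
      obtain ⟨G, hG⟩ := g.exists_rep
      exact eq_of_reps (reps_mul hF (reps_smul hG a)) (reps_smul (reps_mul hF hG) a)
        fun x => mul_left_comm _ _ _)

instance : StarRing (Linf B) where
  star_involutive f := by
    obtain ⟨F, hF⟩ := f.exists_rep
    exact eq_of_reps (reps_star (reps_star hF)) hF fun x => star_star _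
  star_mul f g := by
    obtain ⟨F, hF⟩ := f.exists_rep
    obtain ⟨G, hG⟩ := g.exists_rep
    exact eq_of_reps (reps_star (reps_mul hF hG)) (reps_mul (reps_star hG) (reps_star hF))
      fun x => star_mul _ _
  star_add f g := by
    obtain ⟨F, hF⟩ := f.exists_rep
    obtain ⟨G, hG⟩ := g.exists_rep
    exact eq_of_reps (reps_star (reps_add hF hG)) (reps_add (reps_star hF) (reps_star hG))
      fun x => star_add _ _

instance : StarModule ℂ (Linf B) where
  star_smul a f := by
    obtain ⟨F, hF⟩ := f.exists_rep
    exact eq_of_reps (reps_star (reps_smul hF a)) (reps_smul (reps_star hF) (star a))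
      fun x => star_mul' _ _

theorem norm_smul_le' (c : ℂ) (f : Linf B) : ‖c • f‖ ≤ ‖c‖ * ‖f‖ := by
  obtain ⟨F, hF⟩ := f.exists_rep
  refine (norm_le_iff (reps_smul hF c) (mul_nonneg (norm_nonneg c) (norm_nonneg' f))).2 ?_
  filter_upwards [ae_norm_le hF] with x hx
  rw [norm_mul]
  gcongr

theorem normCore : NormedSpace.Core ℂ (Linf B) where
  norm_nonneg := norm_nonneg'
  norm_smul c f := by
    refine le_antisymm (norm_smul_le' c f) ?_
    by_cases hc : c = 0
    · simpa [hc] using norm_nonneg' ((0 : ℂ) • f)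
    · have h := norm_smul_le' c⁻¹ (c • f)
      rw [smul_smul, inv_mul_cancel₀ hc, one_smul, norm_inv] at h
      have hc' : 0 < ‖c‖ := norm_pos_iff.2 hc
      calc ‖c‖ * ‖f‖ ≤ ‖c‖ * (‖c‖⁻¹ * ‖c • f‖) := by gcongr
        _ = ‖c • f‖ := by field_simp
  norm_triangle f g := by
    obtain ⟨F, hF⟩ := f.exists_rep
    obtain ⟨G, hG⟩ := g.exists_rep
    refine (norm_le_iff (reps_add hF hG) (add_nonneg (norm_nonneg' f) (norm_nonneg' g))).2 ?_
    filter_upwards [ae_norm_le hF, ae_norm_le hG] with x hx hy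
    exact (norm_add_le _ _).trans (add_le_add hx hy)
  norm_eq_zero_iff f := by
    obtain ⟨F, hF⟩ := f.exists_rep
    constructor
    · intro h
      refine Linf.ext (hF.unique reps_zero ?_)
      filter_upwards [ae_norm_le hF] with x hx
      rw [h] at hx
      exact norm_le_zero_iff.1 hx
    · rintro rfl
      refine le_antisymm ((norm_le_iff reps_zero le_rfl).2 ?_) (norm_nonneg' _)
      simp

instance : NormedCommRing (Linf B) :=
  { NormedAddCommGroup.ofCore normCore, (inferInstance : CommRing (Linf B)) with
    norm_mul_le := fun f g => by
      obtain ⟨F, hF⟩ := f.exists_rep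
      obtain ⟨G, hG⟩ := g.exists_rep
      refine (norm_le_iff (reps_mul hF hG) (mul_nonneg (norm_nonneg' f) (norm_nonneg' g))).2 ?_
      filter_upwards [ae_norm_le hF, ae_norm_le hG] with x hx hy
      rw [norm_mul]
      exact mul_le_mul hx hy (norm_nonneg _) (norm_nonneg' f) }

instance : NormedAlgebra ℂ (Linf B) where
  norm_smul_le := norm_smul_le'

instance : CStarRing (Linf B) where
  norm_mul_self_le f := by
    obtain ⟨F, hF⟩ := f.exists_rep
    have h := ae_norm_le (reps_mul (reps_star hF) hF)
    have h2 : ‖f‖ ≤ Real.sqrt ‖star f * f‖ := by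
      refine (norm_le_iff hF (Real.sqrt_nonneg _)).2 ?_
      filter_upwards [h] with x hx
      refine Real.le_sqrt_of_sq_le ?_
      rwa [norm_mul, norm_star, ← sq] at hx
    calc ‖f‖ * ‖f‖ ≤ Real.sqrt ‖star f * f‖ * Real.sqrt ‖star f * f‖ := by gcongr
      _ = ‖star f * f‖ := Real.mul_self_sqrt (norm_nonneg' _)

theorem reps_sub {F G : StoneSp B → ℂ} {f g : Linf B} (hF : Reps F f.hom) (hG : Reps G g.hom) :
    Reps (fun x => F x - G x) (f - g).hom := by
  rw [sub_eq_add_neg]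
  simpa only [sub_eq_add_neg] using reps_add hF (reps_neg hG)

instance : CompleteSpace (Linf B) := by
  refine Metric.complete_of_cauchySeq_tendsto fun u hu => ?_
  choose F hF using fun n => (u n).exists_rep
  have hae : ∀ᶠ x in residual (StoneSp B), ∀ n m, ‖F n x - F m x‖ ≤ ‖u n - u m‖ :=
    eventually_countable_forall.2 fun n => eventually_countable_forall.2 fun m =>
      ae_norm_le (reps_sub (hF n) (hF m))
  set S : Set (StoneSp B) := {x | ∀ n m, ‖F n x - F m x‖ ≤ ‖u n - u m‖} with hS
  classical
  let F' : ℕ → StoneSp B → ℂ := fun n x => if x ∈ S then F n x else 0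
  have hF'F : ∀ n, F' n =ᶠ[residual _] F n := fun n => by
    filter_upwards [hae] with x hx
    exact if_pos hx
  have hF' : ∀ n, Reps (F' n) (u n).hom := fun n => (hF n).congr (hF'F n)
  have hdiff : ∀ x n m, ‖F' n x - F' m x‖ ≤ ‖u n - u m‖ := by
    intro x n m
    by_cases hx : x ∈ S
    · simpa only [F', if_pos hx] using hx n m
    · simp [F', hx]
  have hcau : ∀ x, CauchySeq fun n => F' n x := by
    intro x
    rw [Metric.cauchySeq_iff] at hu ⊢
    intro ε hε
    obtain ⟨N, hN⟩ := hu ε hε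
    refine ⟨N, fun m hm n hn => ?_⟩
    have := hN m hm n hn
    rw [dist_eq_norm] at this ⊢
    exact (hdiff x m n).trans_lt this
  choose G hG using fun x => cauchySeq_tendsto_of_complete (hcau x)
  have hGm : Measurable G :=
    measurable_of_tendsto_metrizable (fun n => (hF' n).measurable) (tendsto_pi_nhds.2 hG)
  obtain ⟨g, hg⟩ := exists_of_measurable hGm
  have hbound : ∀ ε > 0, ∃ N, ∀ n ≥ N, ∀ x, ‖F' n x - G x‖ ≤ ε := by
    intro ε hε
    obtain ⟨N, hN⟩ := Metric.cauchySeq_iff.1 hu ε hε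
    refine ⟨N, fun n hn x => ?_⟩
    refine le_of_tendsto ((tendsto_const_nhds.sub (hG x)).norm) ?_
    filter_upwards [eventually_ge_atTop N] with m hm
    have := hN n hn m hm
    rw [dist_eq_norm] at this
    exact (hdiff x n m).trans this.le
  obtain ⟨N, hN⟩ := hbound 1 one_pos
  have hgb : ∀ᶠ x in residual (StoneSp B), ‖G x‖ ≤ ‖u N‖ + 1 := by
    filter_upwards [ae_norm_le (hF' N)] with x hx
    calc ‖G x‖ = ‖F' N x - (F' N x - G x)‖ := by rw [sub_sub_cancel]
      _ ≤ ‖F' N x‖ + ‖F' N x - G x‖ := norm_sub_le _ _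
      _ ≤ _ := add_le_add hx (hN N le_rfl x)
  refine ⟨⟨g, cball (‖u N‖ + 1), Metric.isBounded_closedBall, ?_⟩, ?_⟩
  · refine eq_of_clop_eventuallyEq ((hg _).symm.trans ?_)
    rw [clop_top]
    filter_upwards [hgb] with x hx
    refine eq_true ?_
    change G x ∈ Metric.closedBall 0 _
    simpa using hx
  · rw [Metric.tendsto_atTop]
    intro ε hε
    obtain ⟨N, hN⟩ := hbound (ε / 2) (half_pos hε)
    refine ⟨N, fun n hn => lt_of_le_of_lt ?_ (half_lt_self hε)⟩
    rw [dist_eq_norm]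
    exact (norm_le_iff (reps_sub (hF' n) hg) (half_pos hε).le).2
      (Eventually.of_forall fun x => hN n hn x)

instance : CommCStarAlgebra (Linf B) where

/-- The usual order of a C⋆-algebra: `f ≤ g` iff `g - f` is positive. -/
instance : PartialOrder (Linf B) := CStarAlgebra.spectralOrder (Linf B)

instance : StarOrderedRing (Linf B) := CStarAlgebra.spectralOrderedRing (Linf B)

end Axioms

end Linf

/-! # σC⋆-algebras, σ-normal maps, POVMs and PVMs -/

/-- A σC⋆-algebra: every norm-bounded increasing sequence of self-adjoint elements has a supremum
in the poset of self-adjoint elements. -/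
class IsSigmaCStarAlgebra (A : Type u) [CStarAlgebra A] [PartialOrder A] [StarOrderedRing A] :
    Prop where
  exists_isLUB : ∀ a : ℕ → selfAdjoint A, Monotone a → (∃ C : ℝ, ∀ n, ‖(a n : A)‖ ≤ C) →
    ∃ s, IsLUB (range a) s

section Definitions

variable {B : Type u} [BooleanAlgebra B] {A : Type v} {A' : Type w}
  [CStarAlgebra A] [PartialOrder A] [StarOrderedRing A]
  [CStarAlgebra A'] [PartialOrder A'] [StarOrderedRing A']

/-- `a n ↗ s`: the sequence of self-adjoint elements is norm-bounded and increasing, with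
supremum `s` among the self-adjoint elements. -/
def IncreasesTo (a : ℕ → selfAdjoint A) (s : selfAdjoint A) : Prop :=
  Monotone a ∧ (∃ C : ℝ, ∀ n, ‖(a n : A)‖ ≤ C) ∧ IsLUB (range a) s

/-- A map is σ-normal if `a n ↗ s` implies that `φ s` is the supremum of the `φ (a n)`. For
positive linear `φ` and self-adjoint `a n` it makes no difference whether this supremum is taken in
the codomain or among its self-adjoint elements, since anything above a self-adjoint element is
self-adjoint. -/
def IsSigmaNormal (φ : A → A') : Prop :=
  ∀ (a : ℕ → selfAdjoint A) (s : selfAdjoint A), IncreasesTo a s →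
    IsLUB (range fun n => φ (a n)) (φ s)

/-- The infinite sum of a sequence of positive elements is `s`: the supremum of the finite partial
sums exists and equals `s`. -/
def HasOrderSum (a : ℕ → A) (s : A) : Prop :=
  IsLUB (range fun F : Finset ℕ => ∑ i ∈ F, a i) s

/-- Positive operator valued measures on `B` with values in `A`. -/
structure IsPOVM (μ : B → A) : Prop where
  nonneg : ∀ p, 0 ≤ μ p
  map_top : μ ⊤ = 1
  sigma_additive : ∀ (p : ℕ → B) (s : B), (∀ m n, m ≠ n → p m ⊓ p n = ⊥) →
    IsLUB (range p) s → HasOrderSum (fun n => μ (p n)) (μ s)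

/-- Projection valued measures. -/
structure IsPVM (μ : B → A) : Prop extends IsPOVM μ where
  map_inf : ∀ p q, μ (p ⊓ q) = μ p * μ q

/-- `φ` is a σ-cpu map: completely positive (by its type), unital and σ-normal. -/
def IsSigmaCPU (φ : A →CP A') : Prop := φ 1 = 1 ∧ IsSigmaNormal φ

end Definitions

end PovmIntegration

end

open PovmIntegration

/-!
In the Stone space of `B`, modulo meagre sets, the elements of `Linf B` are the bounded measurable
functions and the elements of `B` are the measurable sets, so a POVM is an additive operator-valued
set function on the Stone space that vanishes on meagre sets. Its integral on simple functions is
bounded in norm by a Cauchy–Schwarz inequality, hence extends to `Linf B` by density, and stays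
completely positive because a positive matrix of simple functions has positive values. For a
PVM the integral is multiplicative on indicators, hence everywhere. Countable additivity gives
σ-normality through Egorov's argument: outside a class `e n` with `e n ↓ ⊥` an increasing sequence
is within `ε` of its supremum. Uniqueness holds because positive maps are continuous and the `χ_p`
span a dense subspace.
-/

noncomputable section

namespace PovmIntegration

open MeasureTheory

theorem le_of_forall_pos_le_add_smul {E : Type*} [AddCommGroup E] [Module ℝ E] [PartialOrder E]
    [TopologicalSpace E] [ContinuousAdd E] [ContinuousSMul ℝ E] [OrderClosedTopology E]
    {x y z : E} (h : ∀ ε : ℝ, 0 < ε → x ≤ y + ε • z) : x ≤ y := by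
  have hlim : Tendsto (fun ε : ℝ => y + ε • z) (𝓝[>] 0) (𝓝 (y + (0 : ℝ) • z)) :=
    (by fun_prop : Continuous fun ε : ℝ => y + ε • z).continuousWithinAt
  rw [zero_smul, add_zero] at hlim
  exact ge_of_tendsto hlim (eventually_nhdsWithin_of_forall h)

theorem sum_range_succ_eq_partialSups {L M : Type*} [DistribLattice L] [OrderBot L]
    [AddCommMonoid M] {ν : L → M} (hν : ∀ p q, p ⊓ q = ⊥ → ν (p ⊔ q) = ν p + ν q) {p : ℕ → L}
    (hp : ∀ m n, m ≠ n → p m ⊓ p n = ⊥) (n : ℕ) :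
    ∑ i ∈ Finset.range (n + 1), ν (p i) = ν (partialSups p n) := by
  induction n with
  | zero => simp
  | succ n ih =>
    have hdisj : Disjoint (partialSups p n) (p (n + 1)) :=
      disjoint_partialSups_left.2 fun i hi => disjoint_iff.2 (hp _ _ (by lia))
    rw [Finset.sum_range_succ, ih, ← hν _ _ hdisj.eq_bot, ← Order.succ_eq_add_one,
      partialSups_succ]

section Measure

variable {B : Type*} [BooleanAlgebra B] {A : Type*} [CStarAlgebra A] [PartialOrder A]
  [StarOrderedRing A] {μ : B → A}

theorem hasOrderSum_iff_isLUB_sum_range {a : ℕ → A} (ha : ∀ n, 0 ≤ a n) {s : A} :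
    HasOrderSum a s ↔ IsLUB (range fun n => ∑ i ∈ Finset.range (n + 1), a i) s := by
  refine isLUB_congr (Set.ext fun b => ⟨?_, ?_⟩)
  · rintro hb _ ⟨n, rfl⟩
    exact hb ⟨_, rfl⟩
  · rintro hb _ ⟨F, rfl⟩
    refine le_trans ?_ (hb ⟨F.sup id, rfl⟩)
    exact Finset.sum_le_sum_of_subset_of_nonneg F.subset_range_sup_succ fun i _ _ => ha i

theorem hasOrderSum_sum {a : ℕ → A} (ha : ∀ n, 0 ≤ a n) {F : Finset ℕ}
    (hF : ∀ n ∉ F, a n = 0) : HasOrderSum a (∑ n ∈ F, a n) := by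
  refine IsGreatest.isLUB ⟨⟨F, rfl⟩, ?_⟩
  rintro _ ⟨G, rfl⟩
  calc ∑ n ∈ G, a n ≤ ∑ n ∈ F ∪ G, a n :=
        Finset.sum_le_sum_of_subset_of_nonneg Finset.subset_union_right fun n _ _ => ha n
    _ = ∑ n ∈ F, a n :=
        (Finset.sum_subset Finset.subset_union_left fun n _ hn => hF n hn).symm

namespace IsPOVM

theorem map_bot (h : IsPOVM μ) : μ ⊥ = 0 := by
  have hsum := h.sigma_additive (fun _ => ⊥) ⊥ (by simp) (by simp)
  have htwo : μ ⊥ + μ ⊥ ≤ μ ⊥ := hsum.1 ⟨{0, 1}, by simp [two_mul]⟩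
  exact le_antisymm (by simpa using htwo) (h.nonneg ⊥)

theorem map_sup (h : IsPOVM μ) {p q : B} (hpq : p ⊓ q = ⊥) : μ (p ⊔ q) = μ p + μ q := by
  let u : ℕ → B := fun n => if n = 0 then p else if n = 1 then q else ⊥
  have hu : IsLUB (range u) (p ⊔ q) := by
    refine ⟨?_, fun b hb => sup_le (hb ⟨0, rfl⟩) (hb ⟨1, rfl⟩)⟩
    rintro _ ⟨n, rfl⟩
    simp only [u]
    split_ifs <;> simp
  have hdisj : ∀ m n, m ≠ n → u m ⊓ u n = ⊥ := by
    intro m n hmn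
    simp only [u]
    split_ifs <;> simp_all [inf_comm]
  have hsupp : ∀ n ∉ ({0, 1} : Finset ℕ), μ (u n) = 0 := fun n hn => by
    simp_all [u, h.map_bot]
  simpa [u] using (h.sigma_additive u _ hdisj hu).unique
    (hasOrderSum_sum (fun n => h.nonneg _) hsupp)

theorem mono (h : IsPOVM μ) {p q : B} (hpq : p ≤ q) : μ p ≤ μ q :=
  calc μ p ≤ μ p + μ (q \ p) := le_add_of_nonneg_right (h.nonneg _)
    _ = μ (p ⊔ q \ p) := (h.map_sup inf_sdiff_self_right).symm
    _ = μ q := by rw [sup_sdiff_cancel_right hpq]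

theorem map_compl (h : IsPOVM μ) (p : B) : μ pᶜ = 1 - μ p := by
  rw [eq_sub_iff_add_eq', ← h.map_sup (inf_compl_self p), sup_compl_eq_top, h.map_top]

theorem isLUB_of_monotone (h : IsPOVM μ) {d : ℕ → B} {s : B} (hd : Monotone d)
    (hs : IsLUB (range d) s) : IsLUB (range fun n => μ (d n)) (μ s) := by
  have hps : partialSups (disjointed d) = d := by rw [partialSups_disjointed, hd.partialSups_eq]
  have hdisj : ∀ m n, m ≠ n → disjointed d m ⊓ disjointed d n = ⊥ := fun m n hmn =>
    (disjoint_disjointed d hmn).eq_bot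
  have hlub : IsLUB (range (disjointed d)) s := by
    rwa [IsLUB, ← upperBounds_range_partialSups, hps]
  have hsum := (hasOrderSum_iff_isLUB_sum_range fun n => h.nonneg _).1
    (h.sigma_additive _ s hdisj hlub)
  simpa only [sum_range_succ_eq_partialSups (fun _ _ => h.map_sup) hdisj, hps] using hsum

theorem isGLB_of_antitone (h : IsPOVM μ) {e : ℕ → B} {s : B} (he : Antitone e)
    (hs : IsGLB (range e) s) : IsGLB (range fun n => μ (e n)) (μ s) := by
  refine ⟨?_, fun b hb => ?_⟩
  · rintro _ ⟨n, rfl⟩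
    exact h.mono (hs.1 ⟨n, rfl⟩)
  have hcompl : IsLUB (range fun n => (e n)ᶜ) sᶜ := by
    refine ⟨?_, fun c hc => compl_le_of_compl_le (hs.2 ?_)⟩
    · rintro _ ⟨n, rfl⟩
      exact compl_le_compl (hs.1 ⟨n, rfl⟩)
    · rintro _ ⟨n, rfl⟩
      exact compl_le_of_compl_le (hc ⟨n, rfl⟩)
  have hlub := h.isLUB_of_monotone (fun m n hmn => compl_le_compl (he hmn)) hcompl
  simp only [h.map_compl] at hlub
  refine (sub_le_sub_iff_left 1).1 (hlub.2 ?_)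
  rintro _ ⟨n, rfl⟩
  exact sub_le_sub_left (hb ⟨n, rfl⟩) 1

theorem of_isLUB_of_monotone (hnonneg : ∀ p, 0 ≤ μ p) (htop : μ ⊤ = 1)
    (hsup : ∀ p q, p ⊓ q = ⊥ → μ (p ⊔ q) = μ p + μ q)
    (hlub : ∀ (d : ℕ → B) (s : B), Monotone d → IsLUB (range d) s →
      IsLUB (range fun n => μ (d n)) (μ s)) : IsPOVM μ where
  nonneg := hnonneg
  map_top := htop
  sigma_additive p s hp hs := by
    have hps : IsLUB (range (partialSups p)) s := by
      rwa [IsLUB, upperBounds_range_partialSups]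
    rw [hasOrderSum_iff_isLUB_sum_range fun n => hnonneg _]
    simpa only [sum_range_succ_eq_partialSups hsup hp] using
      hlub _ s (partialSups p).monotone hps

end IsPOVM

end Measure

section Norm

variable {A : Type*} [NonUnitalCStarAlgebra A] [PartialOrder A] [StarOrderedRing A] {ι : Type*}
  {s : Finset ι} {c : ι → ℂ} {a : ι → A}

-- Cauchy–Schwarz in the Hilbert module `s → A`, for the vectors `√(a i)` and `c i • √(a i)`.
theorem norm_sum_smul_sq_le (ha : ∀ i, 0 ≤ a i) :
    ‖∑ i ∈ s, c i • a i‖ ^ 2 ≤ ‖∑ i ∈ s, a i‖ * ‖∑ i ∈ s, ‖c i‖ ^ 2 • a i‖ := by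
  have hsqrt : ∀ i, CFC.sqrt (a i) * star (CFC.sqrt (a i)) = a i := fun i => by
    rw [(CFC.sqrt_nonneg (a i)).isSelfAdjoint.star_eq, CFC.sqrt_mul_sqrt_self _ (ha i)]
  let toModule : (s → A) → WithCStarModule A (s → A) := (WithCStarModule.equiv A (s → A)).symm
  let x := toModule fun i => CFC.sqrt (a i)
  let y := toModule fun i => c i • CFC.sqrt (a i)
  have hxy : inner A x y = ∑ i ∈ s, c i • a i := by
    rw [← Finset.sum_coe_sort s]
    exact Finset.sum_congr rfl fun i _ => by
      change c i • CFC.sqrt (a i) * star (CFC.sqrt (a i)) = _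
      rw [smul_mul_assoc, hsqrt]
  have hxx : inner A x x = ∑ i ∈ s, a i := by
    rw [← Finset.sum_coe_sort s]
    exact Finset.sum_congr rfl fun i _ => hsqrt i
  have hyy : inner A y y = ∑ i ∈ s, ‖c i‖ ^ 2 • a i := by
    rw [← Finset.sum_coe_sort s]
    exact Finset.sum_congr rfl fun i _ => by
      change c i • CFC.sqrt (a i) * star (c i • CFC.sqrt (a i)) = _
      rw [star_smul, smul_mul_smul_comm, hsqrt, Complex.star_def, Complex.mul_conj']
      norm_cast
  calc ‖∑ i ∈ s, c i • a i‖ ^ 2 ≤ (‖x‖ * ‖y‖) ^ 2 := by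
        rw [← hxy]
        gcongr
        exact CStarModule.norm_inner_le _
    _ = ‖∑ i ∈ s, a i‖ * ‖∑ i ∈ s, ‖c i‖ ^ 2 • a i‖ := by
        rw [mul_pow, CStarModule.norm_sq_eq A, CStarModule.norm_sq_eq A, hxx, hyy]

theorem norm_sum_smul_le {r : ℝ} (ha : ∀ i, 0 ≤ a i) (hr : 0 ≤ r)
    (hc : ∀ i ∈ s, a i ≠ 0 → ‖c i‖ ≤ r) : ‖∑ i ∈ s, c i • a i‖ ≤ r * ‖∑ i ∈ s, a i‖ := by
  have hle : ∑ i ∈ s, ‖c i‖ ^ 2 • a i ≤ r ^ 2 • ∑ i ∈ s, a i := by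
    rw [Finset.smul_sum]
    refine Finset.sum_le_sum fun i hi => ?_
    rcases eq_or_ne (a i) 0 with h0 | h0
    · simp [h0]
    · exact smul_le_smul_of_nonneg_right (by gcongr; exact hc i hi h0) (ha i)
  have hnorm : ‖∑ i ∈ s, ‖c i‖ ^ 2 • a i‖ ≤ r ^ 2 * ‖∑ i ∈ s, a i‖ := by
    refine (CStarAlgebra.norm_le_norm_of_nonneg_of_le ?_ hle).trans_eq ?_
    · exact Finset.sum_nonneg fun i _ => smul_nonneg (by positivity) (ha i)
    · rw [norm_smul, Real.norm_of_nonneg (by positivity)]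
  refine le_of_sq_le_sq ?_ (by positivity)
  calc ‖∑ i ∈ s, c i • a i‖ ^ 2 ≤ ‖∑ i ∈ s, a i‖ * ‖∑ i ∈ s, ‖c i‖ ^ 2 • a i‖ :=
        norm_sum_smul_sq_le ha
    _ ≤ ‖∑ i ∈ s, a i‖ * (r ^ 2 * ‖∑ i ∈ s, a i‖) := by gcongr
    _ = (r * ‖∑ i ∈ s, a i‖) ^ 2 := by ring

end Norm

theorem measurableSet_clop {B : Type*} [BooleanAlgebra B] [IsBooleanSigmaAlgebra B] (p : B) :
    MeasurableSet (clop p) :=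
  ⟨p, .rfl⟩

namespace Linf

variable {B : Type*} [BooleanAlgebra B]

theorem reps_chi (p : B) : Reps ((clop p).indicator 1) (chi p).hom := by
  classical
  intro U
  refine EventuallyEq.of_eq (Set.ext fun x => ?_)
  change (clop p).indicator (1 : StoneSp B → ℂ) x ∈ (U : Set ℂ) ↔ x ∈ clop
    ((if (1 : ℂ) ∈ (U : Set ℂ) then p else ⊥) ⊔ (if (0 : ℂ) ∈ (U : Set ℂ) then pᶜ else ⊥))
  rw [clop_sup]
  by_cases hx : x ∈ clop p <;> by_cases h1 : (1 : ℂ) ∈ (U : Set ℂ) <;>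
    by_cases h0 : (0 : ℂ) ∈ (U : Set ℂ) <;> simp [hx, h0, h1, clop_compl, clop_bot]

theorem chi_top : chi (⊤ : B) = 1 :=
  eq_of_reps (reps_chi _) reps_one fun x => by simp [clop_top]

theorem star_chi (p : B) : star (chi p) = chi p :=
  eq_of_reps (reps_star (reps_chi p)) (reps_chi p) fun x => by
    by_cases hp : x ∈ clop p <;> simp [hp]

theorem norm_chi_le (p : B) : ‖chi p‖ ≤ 1 :=
  (norm_le_iff (reps_chi p) zero_le_one).2 <| Eventually.of_forall fun x => by
    by_cases hp : x ∈ clop p <;> simp [hp]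

variable [IsBooleanSigmaAlgebra B]

theorem chi_inf (p q : B) : chi (p ⊓ q) = chi p * chi q :=
  eq_of_reps (reps_chi _) (reps_mul (reps_chi p) (reps_chi q)) fun x => by
    rw [clop_inf, inter_indicator_one, Pi.mul_apply]

theorem chi_sup {p q : B} (hpq : p ⊓ q = ⊥) : chi (p ⊔ q) = chi p + chi q := by
  have hdisj : Disjoint (clop p) (clop q) := by
    rw [disjoint_iff_inter_eq_empty, ← clop_inf, hpq, clop_bot]
  exact eq_of_reps (reps_chi _) (reps_add (reps_chi p) (reps_chi q)) fun x => by
    rw [clop_sup, indicator_union_of_disjoint hdisj]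

theorem ae_eq_of_reps {F G : StoneSp B → ℂ} {f : Linf B} (hF : Reps F f.hom)
    (hG : Reps G f.hom) : F =ᶠ[residual _] G := by
  filter_upwards [ae_norm_le (reps_sub hF hG)] with x hx
  rw [sub_self, norm_zero] at hx
  exact sub_eq_zero.1 (norm_le_zero_iff.1 hx)

theorem exists_reps_of_ae_norm_le {F : StoneSp B → ℂ} (hF : Measurable F) {C : ℝ}
    (hC : ∀ᶠ x in residual (StoneSp B), ‖F x‖ ≤ C) : ∃ f : Linf B, Reps F f.hom := by
  obtain ⟨g, hg⟩ := exists_of_measurable hF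
  have htop : g (cball C) = ⊤ := by
    refine eq_of_clop_eventuallyEq ((hg _).symm.trans ?_)
    rw [clop_top]
    filter_upwards [hC] with x hx
    exact eq_true (mem_closedBall_zero_iff.2 hx)
  exact ⟨⟨g, cball C, Metric.isBounded_closedBall, htop⟩, hg⟩

theorem exists_reps_norm_le (f : Linf B) :
    ∃ F : StoneSp B → ℂ, Reps F f.hom ∧ ∀ x, ‖F x‖ ≤ ‖f‖ := by
  obtain ⟨F, hF⟩ := f.exists_rep
  refine ⟨{x | ‖F x‖ ≤ ‖f‖}.indicator F, hF.congr ?_, fun x => ?_⟩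
  · filter_upwards [ae_norm_le hF] with x hx
    exact indicator_of_mem (s := {x | ‖F x‖ ≤ ‖f‖}) hx F
  · by_cases hx : ‖F x‖ ≤ ‖f‖
    · rwa [indicator_of_mem (s := {x | ‖F x‖ ≤ ‖f‖}) hx]
    · rw [indicator_of_notMem (s := {x | ‖F x‖ ≤ ‖f‖}) hx, norm_zero]
      exact norm_nonneg f

end Linf

/-- `F` is a real-valued point map on the Stone space representing `f`; such a map exists exactly
when `f` is self-adjoint, and the order of `Linf B` is the almost everywhere order of these maps. -/
def RealReps {B : Type*} [BooleanAlgebra B] (F : StoneSp B → ℝ) (f : Linf B) : Prop :=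
  Reps (fun x => (F x : ℂ)) f.hom

namespace RealReps

variable {B : Type*} [BooleanAlgebra B] {F G : StoneSp B → ℝ} {f g : Linf B}

theorem chi (p : B) : RealReps ((clop p).indicator 1) (Linf.chi p) :=
  (Linf.reps_chi p).congr <| Eventually.of_forall fun x => by
    by_cases hp : x ∈ clop p <;> simp [hp]

theorem one : RealReps (1 : StoneSp B → ℝ) (1 : Linf B) := by
  simpa [RealReps] using Linf.reps_one

theorem ae_abs_le (hF : RealReps F f) : ∀ᶠ x in residual (StoneSp B), |F x| ≤ ‖f‖ := by
  simpa using Linf.ae_norm_le hF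

theorem isSelfAdjoint (hF : RealReps F f) : IsSelfAdjoint f :=
  Linf.eq_of_reps (Linf.reps_star hF) hF fun _ => Complex.conj_ofReal _

variable [IsBooleanSigmaAlgebra B]

theorem smul (hF : RealReps F f) (c : ℝ) : RealReps (fun x => c * F x) (c • f) := by
  simpa [RealReps] using Linf.reps_smul hF (c : ℂ)

theorem measurable (hF : RealReps F f) : Measurable F :=
  Complex.measurable_re.comp (Reps.measurable (F := fun x => (F x : ℂ)) hF)

theorem add (hF : RealReps F f) (hG : RealReps G g) :
    RealReps (fun x => F x + G x) (f + g) := by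
  simpa [RealReps] using Linf.reps_add hF hG

theorem nonneg_iff (hF : RealReps F f) : 0 ≤ f ↔ ∀ᶠ x in residual (StoneSp B), 0 ≤ F x := by
  constructor
  · intro hf
    obtain ⟨g, rfl⟩ := CStarAlgebra.nonneg_iff_eq_star_mul_self.1 hf
    obtain ⟨G, hG⟩ := g.exists_rep
    filter_upwards [Linf.ae_eq_of_reps hF (Linf.reps_mul (Linf.reps_star hG) hG)] with x hx
    rw [Complex.star_def, Complex.conj_mul'] at hx
    norm_cast at hx
    rw [hx]
    positivity
  · intro hpos
    have hm : Measurable fun x => ((√(F x) : ℝ) : ℂ) := by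
      have := hF.measurable
      fun_prop
    have hbound : ∀ᶠ x in residual (StoneSp B), ‖((√(F x) : ℝ) : ℂ)‖ ≤ √‖f‖ := by
      filter_upwards [hF.ae_abs_le] with x hx
      rw [Complex.norm_real, Real.norm_of_nonneg (Real.sqrt_nonneg _)]
      exact Real.sqrt_le_sqrt ((le_abs_self _).trans hx)
    obtain ⟨g, hg⟩ := Linf.exists_reps_of_ae_norm_le hm hbound
    have hfg : f = star g * g := by
      refine Linf.ext (Reps.unique hF (Linf.reps_mul (Linf.reps_star hg) hg) ?_)
      filter_upwards [hpos] with x hx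
      rw [Complex.star_def, Complex.conj_ofReal, ← Complex.ofReal_mul, Real.mul_self_sqrt hx]
    exact hfg ▸ star_mul_self_nonneg g

theorem le_iff (hF : RealReps F f) (hG : RealReps G g) :
    f ≤ g ↔ ∀ᶠ x in residual (StoneSp B), F x ≤ G x := by
  have hsub : RealReps (fun x => G x - F x) (g - f) := by
    simpa [RealReps] using Linf.reps_sub hG hF
  simp only [← sub_nonneg (b := f), hsub.nonneg_iff, sub_nonneg]

theorem exists_abs_le (hf : IsSelfAdjoint f) :
    ∃ F : StoneSp B → ℝ, RealReps F f ∧ ∀ x, |F x| ≤ ‖f‖ := by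
  obtain ⟨H, hH, hHf⟩ := f.exists_reps_norm_le
  refine ⟨fun x => (H x).re, hH.congr ?_, fun x => (Complex.abs_re_le_norm _).trans (hHf x)⟩
  have hstar : Reps (fun x => star (H x)) f.hom := by
    simpa only [hf.star_eq] using Linf.reps_star hH
  filter_upwards [Linf.ae_eq_of_reps hstar hH] with x hx
  exact Complex.conj_eq_iff_re.1 hx

theorem exists_iSup {a : ℕ → Linf B} {F : ℕ → StoneSp B → ℝ} (hF : ∀ n, RealReps (F n) (a n))
    {C : ℝ} (hC : ∀ᶠ x in residual (StoneSp B), ∀ n, F n x ≤ C) :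
    ∃ t, RealReps (fun x => ⨆ n, F n x) t := by
  have hm : Measurable fun x => ((⨆ n, F n x : ℝ) : ℂ) :=
    Complex.measurable_ofReal.comp (Measurable.iSup fun n => (hF n).measurable)
  refine Linf.exists_reps_of_ae_norm_le hm (C := max ‖a 0‖ C) ?_
  filter_upwards [hC, (hF 0).ae_abs_le] with x hx hx0
  have hbdd : BddAbove (range fun n => F n x) := ⟨C, by rintro _ ⟨n, rfl⟩; exact hx n⟩
  rw [Complex.norm_real, Real.norm_eq_abs, abs_le']
  exact ⟨(ciSup_le hx).trans (le_max_right _ _), by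
    linarith [le_ciSup hbdd 0, (abs_le.1 hx0).1, le_max_left ‖a 0‖ C]⟩

theorem isLUB_iff {a : ℕ → selfAdjoint (Linf B)} {s : selfAdjoint (Linf B)}
    {F : ℕ → StoneSp B → ℝ} (hF : ∀ n, RealReps (F n) (a n : Linf B))
    (hG : RealReps G (s : Linf B)) :
    IsLUB (range a) s ↔ ∀ᶠ x in residual (StoneSp B), IsLUB (range fun n => F n x) (G x) := by
  constructor
  · intro hs
    have hle : ∀ᶠ x in residual (StoneSp B), ∀ n, F n x ≤ G x :=
      eventually_countable_forall.2 fun n => ((hF n).le_iff hG).1 (hs.1 ⟨n, rfl⟩)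
    obtain ⟨t, ht⟩ := exists_iSup hF (C := ‖(s : Linf B)‖) <| by
      filter_upwards [hle, hG.ae_abs_le] with x hx hxs n
      exact (hx n).trans ((le_abs_self _).trans hxs)
    have hst : s ≤ ⟨t, ht.isSelfAdjoint⟩ := by
      refine hs.2 ?_
      rintro _ ⟨n, rfl⟩
      refine ((hF n).le_iff ht).2 (hle.mono fun x hx => le_ciSup (f := fun n => F n x) ?_ n)
      exact ⟨G x, by rintro _ ⟨m, rfl⟩; exact hx m⟩
    filter_upwards [hle, (hG.le_iff ht).1 hst] with x hx hsup
    refine ⟨by rintro _ ⟨n, rfl⟩; exact hx n, fun b hb => hsup.trans (ciSup_le fun n => ?_)⟩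
    exact hb ⟨n, rfl⟩
  · intro hx
    refine ⟨?_, fun t ht => ?_⟩
    · rintro _ ⟨n, rfl⟩
      exact ((hF n).le_iff hG).2 (hx.mono fun x hx => hx.1 ⟨n, rfl⟩)
    · obtain ⟨H, hH, -⟩ := exists_abs_le t.2
      refine (hG.le_iff hH).2 ?_
      filter_upwards [hx, eventually_countable_forall.2 fun n =>
        ((hF n).le_iff hH).1 (ht ⟨n, rfl⟩)] with x hx hle
      exact hx.2 (by rintro _ ⟨n, rfl⟩; exact hle n)

end RealReps

namespace Linf

variable {B : Type*} [BooleanAlgebra B] [IsBooleanSigmaAlgebra B]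

theorem chi_nonneg (p : B) : 0 ≤ chi p :=
  (RealReps.chi p).nonneg_iff.2 <| Eventually.of_forall <|
    indicator_nonneg fun _ _ => zero_le_one

theorem chi_mono : Monotone (chi : B → Linf B) := fun p q hpq =>
  ((RealReps.chi p).le_iff (RealReps.chi q)).2 <| Eventually.of_forall <|
    indicator_le_indicator_of_subset (clop_mono hpq) fun _ => zero_le_one

theorem increasesTo_chi {d : ℕ → B} {s : B} (hd : Monotone d) (hs : IsLUB (range d) s) :
    IncreasesTo (fun n => (⟨chi (d n), star_chi _⟩ : selfAdjoint (Linf B)))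
      ⟨chi s, star_chi s⟩ := by
  refine ⟨fun m n hmn => chi_mono (hd hmn), ⟨1, fun n => norm_chi_le (d n)⟩, ?_⟩
  refine (RealReps.isLUB_iff (fun n => RealReps.chi (d n)) (RealReps.chi s)).2 ?_
  filter_upwards [clop_isLUB hs] with x hx
  refine ⟨?_, fun b hb => ?_⟩
  · rintro _ ⟨n, rfl⟩
    exact indicator_le_indicator_of_subset (clop_mono (hs.1 ⟨n, rfl⟩)) (fun _ => zero_le_one) x
  · refine indicator_apply_le' (fun hxs => ?_) fun _ => ?_
    · obtain ⟨n, hxn⟩ := mem_iUnion.1 (hx.mp hxs)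
      simpa [hxn] using hb ⟨n, rfl⟩
    · exact (indicator_nonneg (fun _ _ => zero_le_one) x).trans (hb ⟨0, rfl⟩)

-- Egorov's argument, with `e n` the class of `{x | F n x + ε < G x}` for representatives `F n` of
-- `a n` and `G` of `s`.
theorem exists_antitone_le_add_chi {a : ℕ → selfAdjoint (Linf B)} {s : selfAdjoint (Linf B)}
    (has : IncreasesTo a s) {ε : ℝ} (hε : 0 < ε) :
    ∃ (e : ℕ → B) (K : ℝ), Antitone e ∧ IsGLB (range e) ⊥ ∧ 0 < K ∧
      ∀ n, (s : Linf B) ≤ a n + ε • (1 : Linf B) + K • chi (e n) := by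
  obtain ⟨hmono, ⟨C, hC⟩, hlub⟩ := has
  choose F hF hFa using fun n => RealReps.exists_abs_le (a n).2
  obtain ⟨G, hG, hGs⟩ := RealReps.exists_abs_le s.2
  have hU : ∀ n, MeasurableSet {x | F n x + ε < G x} := fun n =>
    measurableSet_lt ((hF n).measurable.add_const ε) hG.measurable
  let e : ℕ → B := fun n => stoneClass ⟨_, hU n⟩
  have he : ∀ n, ∀ᶠ x in residual (StoneSp B), x ∈ clop (e n) ↔ F n x + ε < G x := fun n =>
    (stoneClass_spec ⟨_, hU n⟩).mono fun x hx => (iff_of_eq hx).symm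
  refine ⟨e, C + ‖(s : Linf B)‖ + 1, ?_, ⟨?_, ?_⟩, ?_, fun n => ?_⟩
  · refine antitone_nat_of_succ_le fun n => le_of_clop_eventuallyLE ?_
    filter_upwards [he n, he (n + 1), ((hF n).le_iff (hF (n + 1))).1 (hmono n.le_succ)]
      with x hn hn' hle hx
    exact hn.2 (by linarith [hn'.1 hx])
  · exact fun _ _ => bot_le
  · refine fun b hb => le_of_clop_eventuallyLE ?_
    filter_upwards [eventually_countable_forall.2 he, (RealReps.isLUB_iff hF hG).1 hlub]
      with x hx hxlub hxb
    have hle : G x ≤ G x - ε := hxlub.2 <| by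
      rintro _ ⟨n, rfl⟩
      have := (hx n).1 (clop_mono (hb ⟨n, rfl⟩) hxb)
      linarith
    linarith
  · linarith [(norm_nonneg _).trans (hC 0), norm_nonneg (s : Linf B)]
  · refine (hG.le_iff (((hF n).add ((RealReps.one).smul ε)).add
      ((RealReps.chi (e n)).smul _))).2 ?_
    filter_upwards [he n] with x hx
    by_cases hxe : x ∈ clop (e n)
    · simp only [indicator_of_mem hxe, Pi.one_apply]
      linarith [(abs_le.1 (hGs x)).2, (abs_le.1 ((hFa n x).trans (hC n))).1]
    · simp only [indicator_of_notMem hxe, Pi.one_apply]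
      linarith [not_lt.1 (mt hx.2 hxe)]

end Linf

theorem exists_simpleFunc_dist_le {X E : Type*} [MeasurableSpace X] [PseudoMetricSpace E]
    [MeasurableSpace E] [OpensMeasurableSpace E] {F : X → E} (hF : Measurable F)
    (hb : TotallyBounded (range F)) {ε : ℝ} (hε : 0 < ε) :
    ∃ G : SimpleFunc X E, ∀ x, dist (G x) (F x) ≤ ε := by
  rcases isEmpty_or_nonempty X with hX | ⟨⟨x₀⟩⟩
  · exact ⟨SimpleFunc.ofIsEmpty, isEmptyElim⟩
  obtain ⟨t, ht, hcover⟩ := Metric.totallyBounded_iff.1 hb ε hε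
  obtain ⟨l, hl⟩ : ∃ l : List E, ∀ y ∈ t, y ∈ l := ⟨ht.toFinset.toList, by simp⟩
  let net : ℕ → E := fun n => l.getD n (F x₀)
  refine ⟨(SimpleFunc.nearestPt net l.length).comp F hF, fun x => ?_⟩
  obtain ⟨y, hy, hxy⟩ := mem_iUnion₂.1 (hcover (mem_range_self x))
  obtain ⟨k, hk, rfl⟩ := List.getElem_of_mem (hl y hy)
  have hnearest := SimpleFunc.edist_nearestPt_le net (F x) hk.le
  rw [edist_dist, edist_dist, ENNReal.ofReal_le_ofReal_iff dist_nonneg] at hnearest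
  refine hnearest.trans ?_
  rw [dist_comm]
  simpa only [net, List.getD_eq_getElem _ _ hk] using (Metric.mem_ball.1 hxy).le

namespace Linf

variable {B : Type*} [BooleanAlgebra B] [IsBooleanSigmaAlgebra B]

theorem exists_reps_simpleFunc (F : SimpleFunc (StoneSp B) ℂ) : ∃ f : Linf B, Reps F f.hom :=
  let ⟨_, hC⟩ := F.exists_forall_norm_le
  exists_reps_of_ae_norm_le F.measurable (Eventually.of_forall hC)

/-- The element of `Linf B` represented by a simple function on the Stone space. These elements
are the ones on which the integral is first defined. -/
def ofSimpleFunc : SimpleFunc (StoneSp B) ℂ →ₗ[ℂ] Linf B where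
  toFun F := (exists_reps_simpleFunc F).choose
  map_add' F G := eq_of_reps (exists_reps_simpleFunc (F + G)).choose_spec
    (reps_add (exists_reps_simpleFunc F).choose_spec (exists_reps_simpleFunc G).choose_spec)
    fun _ => rfl
  map_smul' c F := eq_of_reps (exists_reps_simpleFunc (c • F)).choose_spec
    (reps_smul (exists_reps_simpleFunc F).choose_spec c) fun _ => rfl

theorem reps_ofSimpleFunc (F : SimpleFunc (StoneSp B) ℂ) : Reps F (ofSimpleFunc F).hom :=
  (exists_reps_simpleFunc F).choose_spec

theorem ofSimpleFunc_map_star_mul {E : Type*} (G : SimpleFunc (StoneSp B) E) (g g' : E → ℂ) :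
    ofSimpleFunc (G.map fun v => star (g v) * g' v) =
      star (ofSimpleFunc (G.map g)) * ofSimpleFunc (G.map g') :=
  eq_of_reps (reps_ofSimpleFunc _)
    (reps_mul (reps_star (reps_ofSimpleFunc _)) (reps_ofSimpleFunc _)) fun _ => rfl

open Classical in
theorem ofSimpleFunc_piecewise_const {s : Set (StoneSp B)} (hs : MeasurableSet s) (c : ℂ) :
    ofSimpleFunc (SimpleFunc.piecewise s hs (SimpleFunc.const _ c) (SimpleFunc.const _ 0)) =
      c • chi (stoneClass ⟨s, hs⟩) := by
  refine Linf.ext ((reps_ofSimpleFunc _).unique (reps_smul (reps_chi _) c) ?_)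
  filter_upwards [stoneClass_spec ⟨s, hs⟩] with x hx
  have hiff : x ∈ s ↔ x ∈ clop (stoneClass ⟨s, hs⟩) := iff_of_eq hx
  by_cases hxs : x ∈ s
  · simp [hxs, hiff.1 hxs]
  · simp [hxs, mt hiff.2 hxs]

theorem ofSimpleFunc_mem_span (F : SimpleFunc (StoneSp B) ℂ) :
    ofSimpleFunc F ∈ Submodule.span ℂ (range (chi (B := B))) := by
  classical
  induction F using SimpleFunc.induction with
  | const c hs =>
    rw [ofSimpleFunc_piecewise_const]
    exact Submodule.smul_mem _ _ (Submodule.subset_span ⟨_, rfl⟩)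
  | add _ hF hG =>
    rw [map_add]
    exact Submodule.add_mem _ hF hG

theorem exists_simpleFunc_norm_sub_le {ι : Type*} [Finite ι] (f : ι → Linf B) {ε : ℝ}
    (hε : 0 < ε) : ∃ G : SimpleFunc (StoneSp B) (ι → ℂ),
      ∀ i, ‖ofSimpleFunc (G.map fun v => v i) - f i‖ ≤ ε := by
  cases nonempty_fintype ι
  choose F hF hFf using fun i => (f i).exists_reps_norm_le
  have hb : TotallyBounded (range fun x i => F i x) := by
    refine ((isCompact_univ_pi fun i =>
      isCompact_closedBall (0 : ℂ) ‖f i‖).totallyBounded).subset ?_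
    rintro _ ⟨x, rfl⟩ i -
    exact mem_closedBall_zero_iff.2 (hFf i x)
  obtain ⟨G, hG⟩ :=
    exists_simpleFunc_dist_le (measurable_pi_lambda _ fun i => (hF i).measurable) hb hε
  refine ⟨G, fun i => (norm_le_iff (reps_sub (reps_ofSimpleFunc _) (hF i)) hε.le).2 <|
    Eventually.of_forall fun x => ?_⟩
  rw [← dist_eq_norm]
  exact (dist_le_pi_dist (G x) (fun i => F i x) i).trans (hG x)

theorem denseRange_ofSimpleFunc : DenseRange (ofSimpleFunc (B := B)) := by
  refine Metric.denseRange_iff.2 fun f ε hε => ?_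
  obtain ⟨G, hG⟩ := exists_simpleFunc_norm_sub_le (fun _ : Unit => f) (half_pos hε)
  refine ⟨G.map fun v => v (), ?_⟩
  rw [dist_comm, dist_eq_norm]
  exact (hG ()).trans_lt (half_lt_self hε)

theorem dense_span_chi : Dense (Submodule.span ℂ (range (chi (B := B))) : Set (Linf B)) :=
  denseRange_ofSimpleFunc.mono (range_subset_iff.2 ofSimpleFunc_mem_span)

theorem eq_of_eq_chi {E : Type*} [AddCommMonoid E] [Module ℂ E] [TopologicalSpace E] [T2Space E]
    {φ ψ : Linf B →L[ℂ] E} (h : ∀ p, φ (chi p) = ψ (chi p)) : φ = ψ :=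
  ContinuousLinearMap.ext_on dense_span_chi (forall_mem_range.2 h)

theorem eq_of_positive_of_eq_chi {A Φ Ψ : Type*} [CStarAlgebra A] [PartialOrder A]
    [StarOrderedRing A] [FunLike Φ (Linf B) A] [LinearMapClass Φ ℂ (Linf B) A]
    [OrderHomClass Φ (Linf B) A] [FunLike Ψ (Linf B) A] [LinearMapClass Ψ ℂ (Linf B) A]
    [OrderHomClass Ψ (Linf B) A] {φ : Φ} {ψ : Ψ} (h : ∀ p, φ (chi p) = ψ (chi p))
    (f : Linf B) : φ f = ψ f :=
  DFunLike.congr_fun (eq_of_eq_chi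
    (φ := { toLinearMap := (φ : Linf B →ₗ[ℂ] A), cont := map_continuous φ })
    (ψ := { toLinearMap := (ψ : Linf B →ₗ[ℂ] A), cont := map_continuous ψ }) h) f

end Linf

-- Instance search for the continuous functional calculus, which the library lemma asks for, fails
-- on `CStarMatrix` but succeeds for an abstract algebra.
theorem exists_eq_star_mul_self_of_nonneg {A : Type*} [NonUnitalCStarAlgebra A]
    [PartialOrder A] [StarOrderedRing A] {a : A} (ha : 0 ≤ a) : ∃ b, a = star b * b :=
  CStarAlgebra.nonneg_iff_eq_star_mul_self.1 ha

theorem nonneg_map_star_mul_self_smul {A n : Type*} [NonUnitalCStarAlgebra A]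
    [PartialOrder A] [StarOrderedRing A] [Fintype n] (V : Matrix n n ℂ) {a : A} (ha : 0 ≤ a) :
    0 ≤ CStarMatrix.ofMatrix ((star V * V).map (· • a)) := by
  let R := CStarMatrix.ofMatrix (V.map (· • CFC.sqrt a))
  have hR : CStarMatrix.ofMatrix ((star V * V).map (· • a)) = star R * R := by
    ext i j
    change (∑ m, star (V m i) * V m j) • a =
      ∑ m, star (V m i • CFC.sqrt a) * (V m j • CFC.sqrt a)
    simp only [star_smul, smul_mul_smul_comm, (CFC.sqrt_nonneg a).isSelfAdjoint.star_eq,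
      CFC.sqrt_mul_sqrt_self a ha, Finset.sum_smul]
  exact hR ▸ star_mul_self_nonneg R

section StoneContent

variable {B A : Type*} [BooleanAlgebra B] [IsBooleanSigmaAlgebra B] [Zero A] {μ : B → A}
  {s : Set (StoneSp B)}

open Classical in
/-- The finitely additive measure on the Stone space whose value on a set is the value of `μ` at
the class of that set in `B`. Non-measurable sets, which have no class, get the value zero. -/
def stoneContent (μ : B → A) (s : Set (StoneSp B)) : A :=
  if hs : MeasurableSet s then μ (stoneClass ⟨s, hs⟩) else 0

theorem stoneContent_of_ae {p : B} (h : s =ᶠ[residual _] clop p) : stoneContent μ s = μ p := by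
  have hs : MeasurableSet s := ⟨p, h⟩
  rw [stoneContent, dif_pos hs, stoneClass_eq (S := ⟨s, hs⟩) h]

theorem stoneContent_nonneg [Preorder A] (hμ : ∀ p, 0 ≤ μ p) : 0 ≤ stoneContent μ s := by
  rw [stoneContent]
  split_ifs
  exacts [hμ _, le_rfl]

end StoneContent

namespace IsPOVM

variable {B : Type*} [BooleanAlgebra B] [IsBooleanSigmaAlgebra B] {A : Type*} [CStarAlgebra A]
  [PartialOrder A] [StarOrderedRing A] {μ : B → A}

theorem stoneContent_union (h : IsPOVM μ) {s t : Set (StoneSp B)} (hs : MeasurableSet s)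
    (ht : MeasurableSet t) (hst : Disjoint s t) :
    stoneContent μ (s ∪ t) = stoneContent μ s + stoneContent μ t := by
  obtain ⟨p, hp⟩ := hs
  obtain ⟨q, hq⟩ := ht
  have hpq : p ⊓ q = ⊥ := eq_of_clop_eventuallyEq <| by
    rw [clop_inf, clop_bot, ← disjoint_iff_inter_eq_empty.1 hst]
    exact (hp.inter hq).symm
  have hunion : (s ∪ t : Set _) =ᶠ[residual _] clop (p ⊔ q) := by
    rw [clop_sup]
    exact hp.union hq
  rw [stoneContent_of_ae hp, stoneContent_of_ae hq, stoneContent_of_ae hunion, h.map_sup hpq]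

-- `FinMeasAdditive` only tests sets of finite measure; for the zero measure these are all sets.
theorem finMeasAdditive_stoneContent (h : IsPOVM μ) :
    FinMeasAdditive (0 : Measure (StoneSp B)) (stoneContent μ) :=
  fun _ _ hs ht _ _ hst => h.stoneContent_union hs ht hst

theorem sum_stoneContent_fiber (h : IsPOVM μ) {E : Type*} (F : SimpleFunc (StoneSp B) E) :
    ∑ c ∈ F.range, stoneContent μ (F ⁻¹' {c}) = 1 := by
  have hadd := h.finMeasAdditive_stoneContent
  have hempty : stoneContent μ ∅ = 0 := by
    rw [stoneContent_of_ae (p := ⊥) (.of_eq clop_bot.symm), h.map_bot]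
  have hcover : (⋃ c ∈ F.range, F ⁻¹' {c}) = univ := by
    ext x
    simp
  have hdisj : ∀ c ∈ F.range, ∀ d ∈ F.range, c ≠ d → Disjoint (F ⁻¹' {c}) (F ⁻¹' {d}) :=
    fun c _ d _ hcd => (disjoint_singleton.2 hcd).preimage F
  rw [← hadd.map_iUnion_fin_meas_set_eq_sum _ hempty (fun c => F ⁻¹' {c}) F.range
    F.measurableSet_fiber (by simp) hdisj, hcover,
    stoneContent_of_ae (p := ⊤) (.of_eq clop_top.symm), h.map_top]

/-- The map `c ↦ c • stoneContent μ s`, the form in which `SimpleFunc.setToSimpleFunc` takes the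
vector measure `stoneContent μ`. -/
def smulContent (μ : B → A) (s : Set (StoneSp B)) : ℂ →L[ℝ] A :=
  (ContinuousLinearMap.toSpanSingleton ℂ (stoneContent μ s)).restrictScalars ℝ

theorem finMeasAdditive_smulContent (h : IsPOVM μ) :
    FinMeasAdditive (0 : Measure (StoneSp B)) (smulContent μ) := fun _ _ hs ht _ _ hst =>
  ContinuousLinearMap.ext fun c =>
    (congrArg (c • ·) (h.stoneContent_union hs ht hst)).trans (smul_add c _ _)

/-- The integral of simple functions on the Stone space against `stoneContent μ`. -/
def simpleIntegral (h : IsPOVM μ) : SimpleFunc (StoneSp B) ℂ →ₗ[ℂ] A where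
  toFun F := F.setToSimpleFunc (smulContent μ)
  map_add' _ _ := SimpleFunc.setToSimpleFunc_add _ h.finMeasAdditive_smulContent
    integrable_zero_measure integrable_zero_measure
  map_smul' c _ := SimpleFunc.setToSimpleFunc_smul _ h.finMeasAdditive_smulContent
    (fun c _ x => mul_smul c x _) c integrable_zero_measure

theorem simpleIntegral_map (h : IsPOVM μ) {E : Type*} [NormedAddCommGroup E]
    (G : SimpleFunc (StoneSp B) E) {g : E → ℂ} (hg : g 0 = 0) :
    h.simpleIntegral (G.map g) = ∑ v ∈ G.range, g v • stoneContent μ (G ⁻¹' {v}) :=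
  SimpleFunc.map_setToSimpleFunc _ h.finMeasAdditive_smulContent integrable_zero_measure hg

theorem norm_simpleIntegral_le (h : IsPOVM μ) (F : SimpleFunc (StoneSp B) ℂ) :
    ‖h.simpleIntegral F‖ ≤ ‖(1 : A)‖ * ‖Linf.ofSimpleFunc F‖ := by
  have hfiber : ∀ c ∈ F.range, stoneContent μ (F ⁻¹' {c}) ≠ 0 → ‖c‖ ≤ ‖Linf.ofSimpleFunc F‖ := by
    intro c _
    contrapose!
    intro hc
    have hnull : F ⁻¹' {c} =ᶠ[residual _] clop ⊥ := by
      rw [clop_bot]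
      filter_upwards [Linf.ae_norm_le (Linf.reps_ofSimpleFunc F)] with x hx
      refine eq_false fun hxc : F x = c => ?_
      rw [hxc] at hx
      exact hc.not_ge hx
    rw [stoneContent_of_ae hnull, h.map_bot]
  have hle := norm_sum_smul_le (s := F.range) (c := id)
    (fun _ => stoneContent_nonneg h.nonneg) (norm_nonneg _) hfiber
  rwa [h.sum_stoneContent_fiber, mul_comm] at hle

/-- The integral of a positive operator valued measure. -/
def integral (h : IsPOVM μ) : Linf B →L[ℂ] A := h.simpleIntegral.extendOfNorm Linf.ofSimpleFunc

theorem integral_ofSimpleFunc (h : IsPOVM μ) (F : SimpleFunc (StoneSp B) ℂ) :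
    h.integral (Linf.ofSimpleFunc F) = h.simpleIntegral F :=
  LinearMap.extendOfNorm_eq Linf.denseRange_ofSimpleFunc ⟨_, h.norm_simpleIntegral_le⟩ F

theorem integral_chi (h : IsPOVM μ) (p : B) : h.integral (Linf.chi p) = μ p := by
  classical
  have hp := measurableSet_clop p
  have hclass : stoneClass ⟨clop p, hp⟩ = p := stoneClass_eq .rfl
  have hchi := Linf.ofSimpleFunc_piecewise_const hp 1
  rw [one_smul, hclass] at hchi
  rw [← hchi, integral_ofSimpleFunc]
  refine (SimpleFunc.setToSimpleFunc_indicator _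
    h.finMeasAdditive_smulContent.map_empty_eq_zero hp 1).trans ?_
  exact (one_smul ℂ _).trans (stoneContent_of_ae .rfl)

theorem integral_one (h : IsPOVM μ) : h.integral 1 = 1 := by
  rw [← Linf.chi_top, h.integral_chi, h.map_top]

section CompletelyPositive

variable {n : Type*} [Fintype n]

theorem map_integral_star_mul_self (h : IsPOVM μ) (G : SimpleFunc (StoneSp B) (n × n → ℂ))
    {N : CStarMatrix n n (Linf B)}
    (hN : ∀ i j, N i j = Linf.ofSimpleFunc (G.map fun v => v (i, j))) :
    (star N * N).map h.integral = ∑ v ∈ G.range, CStarMatrix.ofMatrix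
      ((star (Matrix.of v.curry) * Matrix.of v.curry).map (· • stoneContent μ (G ⁻¹' {v}))) := by
  ext i j
  have hsum : ∀ F : (n × n → ℂ) → CStarMatrix n n A,
      (∑ v ∈ G.range, F v) i j = ∑ v ∈ G.range, F v i j := fun F =>
    Matrix.sum_apply i j _ F
  rw [hsum, CStarMatrix.map_apply, CStarMatrix.mul_apply, map_sum]
  change _ = ∑ v ∈ G.range, (∑ m, star (v (m, i)) * v (m, j)) • stoneContent μ (G ⁻¹' {v})
  simp only [Finset.sum_smul]
  rw [Finset.sum_comm]
  refine Finset.sum_congr rfl fun m _ => ?_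
  rw [CStarMatrix.star_apply, hN, hN, ← Linf.ofSimpleFunc_map_star_mul, integral_ofSimpleFunc,
    h.simpleIntegral_map G (by simp)]

theorem map_integral_star_mul_self_nonneg (h : IsPOVM μ) (N : CStarMatrix n n (Linf B)) :
    0 ≤ (star N * N).map h.integral := by
  choose G hG using fun k : ℕ => Linf.exists_simpleFunc_norm_sub_le
    (fun ij : n × n => N ij.1 ij.2) (Nat.one_div_pos_of_nat (α := ℝ) (n := k))
  let N' : ℕ → CStarMatrix n n (Linf B) := fun k =>
    CStarMatrix.ofMatrix fun i j => Linf.ofSimpleFunc ((G k).map fun v => v (i, j))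
  have hN' : ∀ i j, Tendsto (fun k => N' k i j) atTop (𝓝 (N i j)) := fun i j =>
    tendsto_iff_norm_sub_tendsto_zero.2 <| squeeze_zero (fun _ => norm_nonneg _)
      (fun k => hG k (i, j)) tendsto_one_div_add_atTop_nhds_zero_nat
  have hlim : Tendsto (fun k => (star (N' k) * N' k).map h.integral) atTop
      (𝓝 ((star N * N).map h.integral)) := by
    refine tendsto_pi_nhds.2 fun i => tendsto_pi_nhds.2 fun j => ?_
    refine (h.integral.continuous.tendsto ((star N * N) i j)).comp ?_
    simp only [CStarMatrix.mul_apply, CStarMatrix.star_apply]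
    exact tendsto_finsetSum _ fun m _ => (hN' m i).star.mul (hN' m j)
  refine ge_of_tendsto' hlim fun k => ?_
  rw [h.map_integral_star_mul_self (N := N' k) (G k) fun _ _ => rfl]
  exact Finset.sum_nonneg fun v _ =>
    nonneg_map_star_mul_self_smul _ (stoneContent_nonneg h.nonneg)

end CompletelyPositive

/-- The integral of a positive operator valued measure, as a completely positive map. -/
def integralCP (h : IsPOVM μ) : Linf B →CP A where
  toLinearMap := h.integral.toLinearMap
  map_cstarMatrix_nonneg' k M hM := by
    obtain ⟨N, rfl⟩ := exists_eq_star_mul_self_of_nonneg hM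
    exact h.map_integral_star_mul_self_nonneg N

theorem integral_star (h : IsPOVM μ) (f : Linf B) : h.integral (star f) = star (h.integral f) :=
  map_star (PositiveLinearMap.ofClass h.integralCP : Linf B →ₚ[ℂ] A) f

end IsPOVM

namespace IsPVM

variable {B : Type*} [BooleanAlgebra B] [IsBooleanSigmaAlgebra B] {A : Type*} [CStarAlgebra A]
  [PartialOrder A] [StarOrderedRing A] {μ : B → A}

-- Both sides are continuous and linear in each variable, so it suffices to compare them at `chi`.
theorem integral_mul (h : IsPVM μ) (f g : Linf B) :
    h.toIsPOVM.integral (f * g) = h.toIsPOVM.integral f * h.toIsPOVM.integral g := by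
  let I := h.toIsPOVM.integral
  have hchi : ∀ q, I ∘L (ContinuousLinearMap.mul ℂ (Linf B)).flip (Linf.chi q) =
      (ContinuousLinearMap.mul ℂ A).flip (I (Linf.chi q)) ∘L I := fun q =>
    Linf.eq_of_eq_chi fun p => by
      change I (Linf.chi p * Linf.chi q) = I (Linf.chi p) * I (Linf.chi q)
      simp only [← Linf.chi_inf, I, h.toIsPOVM.integral_chi, h.map_inf]
  have hmul : I ∘L ContinuousLinearMap.mul ℂ (Linf B) f =
      ContinuousLinearMap.mul ℂ A (I f) ∘L I :=
    Linf.eq_of_eq_chi fun q => DFunLike.congr_fun (hchi q) f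
  exact DFunLike.congr_fun hmul g

/-- The integral of a projection valued measure, as a star homomorphism. -/
def integralHom (h : IsPVM μ) : Linf B →⋆ₐ[ℂ] A where
  toAlgHom := AlgHom.ofLinearMap h.toIsPOVM.integral.toLinearMap h.toIsPOVM.integral_one
    h.integral_mul
  map_star' := h.toIsPOVM.integral_star

end IsPVM

section SigmaNormal

variable {B : Type*} [BooleanAlgebra B] [IsBooleanSigmaAlgebra B] {A : Type*} [CStarAlgebra A]
  [PartialOrder A] [StarOrderedRing A] {μ : B → A} {Φ : Type*} [FunLike Φ (Linf B) A]
  [LinearMapClass Φ ℂ (Linf B) A] [OrderHomClass Φ (Linf B) A] {φ : Φ}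

theorem IsSigmaNormal.isPOVM (hφ : IsSigmaNormal φ) (hone : φ 1 = 1) :
    IsPOVM fun p => φ (Linf.chi p) := by
  refine .of_isLUB_of_monotone (fun p => ?_) ?_ (fun p q hpq => ?_) fun d s hd hs => ?_
  · exact (map_zero φ).ge.trans (OrderHomClass.mono φ (Linf.chi_nonneg p))
  · rw [Linf.chi_top, hone]
  · rw [Linf.chi_sup hpq, map_add]
  · exact hφ _ _ (Linf.increasesTo_chi hd hs)

-- By Egorov's estimate `φ s ≤ φ (a n) + ε + K • φ (chi (e n))`, where `φ (chi (e n))` decreases to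
-- zero by σ-additivity.
theorem IsPOVM.isSigmaNormal (h : IsPOVM fun p => φ (Linf.chi p)) : IsSigmaNormal φ := by
  intro a s has
  refine ⟨?_, fun b hb => le_of_forall_pos_le_add_smul (z := (1 : A)) fun ε hε => ?_⟩
  · rintro _ ⟨n, rfl⟩
    exact OrderHomClass.mono φ (has.2.2.1 ⟨n, rfl⟩)
  obtain ⟨e, K, he, hebot, hK, hle⟩ := Linf.exists_antitone_le_add_chi has hε
  have hone : φ 1 = 1 := by rw [← Linf.chi_top, h.map_top]
  have hreal : ∀ (r : ℝ) (f : Linf B), φ (r • f) = r • φ f := fun r f =>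
    (φ : Linf B →ₗ[ℂ] A).map_smul_of_tower r f
  have hbound : ∀ n, K⁻¹ • (φ s - (b + ε • (1 : A))) ≤ φ (Linf.chi (e n)) := fun n => by
    rw [inv_smul_le_iff_of_pos hK, sub_le_iff_le_add']
    calc φ s ≤ φ (a n + ε • (1 : Linf B) + K • Linf.chi (e n)) := OrderHomClass.mono φ (hle n)
      _ = φ (a n) + ε • (1 : A) + K • φ (Linf.chi (e n)) := by
        rw [map_add, map_add, hreal, hreal, hone]
      _ ≤ b + ε • (1 : A) + K • φ (Linf.chi (e n)) := by
        gcongr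
        exact hb ⟨n, rfl⟩
  have hzero := (h.isGLB_of_antitone he hebot).2 (forall_mem_range.2 hbound)
  rwa [h.map_bot, inv_smul_le_iff_of_pos hK, smul_zero, sub_nonpos] at hzero

theorem IsPOVM.isSigmaCPU_integralCP (h : IsPOVM μ) : IsSigmaCPU h.integralCP :=
  ⟨h.integral_one, IsPOVM.isSigmaNormal <| (funext h.integral_chi).symm ▸ h⟩

theorem IsPVM.isSigmaNormal_integralHom (h : IsPVM μ) : IsSigmaNormal h.integralHom :=
  h.toIsPOVM.isSigmaCPU_integralCP.2

theorem IsSigmaNormal.isPVM {φ : Linf B →⋆ₐ[ℂ] A} (hφ : IsSigmaNormal φ) :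
    IsPVM fun p => φ (Linf.chi p) where
  toIsPOVM := hφ.isPOVM (map_one φ)
  map_inf p q := by rw [Linf.chi_inf, map_mul]

end SigmaNormal

end PovmIntegration

end

theorem theorem4p17_general {B : Type*} [BooleanAlgebra B] [IsBooleanSigmaAlgebra B]
    {A : Type*} [CStarAlgebra A] [PartialOrder A] [StarOrderedRing A] :
    (∀ μ : B → A, IsPOVM μ →
      (∃! φ : Linf B →CP A, IsSigmaCPU φ ∧ ∀ p, φ (Linf.chi p) = μ p) ∧
      (∀ (φ : Linf B →CP A) (ψ : Linf B →ₚ[ℂ] A), IsSigmaCPU φ → (∀ p, φ (Linf.chi p) = μ p) →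
        (∀ p, ψ (Linf.chi p) = μ p) → ∀ f, ψ f = φ f)) ∧
    (∀ φ : Linf B →CP A, IsSigmaCPU φ → IsPOVM fun p => φ (Linf.chi p)) ∧
    (∀ μ : B → A, IsPVM μ →
      (∃! φ : Linf B →⋆ₐ[ℂ] A, IsSigmaNormal φ ∧ ∀ p, φ (Linf.chi p) = μ p) ∧
      (∀ (φ : Linf B →⋆ₐ[ℂ] A) (ψ : Linf B →ₚ[ℂ] A), IsSigmaNormal φ →
        (∀ p, φ (Linf.chi p) = μ p) → (∀ p, ψ (Linf.chi p) = μ p) → ∀ f, ψ f = φ f)) ∧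
    (∀ φ : Linf B →⋆ₐ[ℂ] A, IsSigmaNormal φ → IsPVM fun p => φ (Linf.chi p)) := by
  refine ⟨fun μ h => ⟨⟨h.integralCP, ⟨h.isSigmaCPU_integralCP, h.integral_chi⟩, ?_⟩, ?_⟩,
    fun φ hφ => hφ.2.isPOVM hφ.1,
    fun μ h => ⟨⟨h.integralHom, ⟨h.isSigmaNormal_integralHom, h.toIsPOVM.integral_chi⟩, ?_⟩, ?_⟩,
    fun φ hφ => hφ.isPVM⟩
  · rintro φ ⟨-, hφ⟩
    exact DFunLike.ext _ _ (Linf.eq_of_positive_of_eq_chi fun p =>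
      (hφ p).trans (h.integral_chi p).symm)
  · exact fun φ ψ _ hφ hψ => Linf.eq_of_positive_of_eq_chi fun p => (hψ p).trans (hφ p).symm
  · rintro φ ⟨-, hφ⟩
    exact DFunLike.ext _ _ (Linf.eq_of_positive_of_eq_chi fun p =>
      (hφ p).trans (h.toIsPOVM.integral_chi p).symm)
  · exact fun φ ψ _ hφ hψ => Linf.eq_of_positive_of_eq_chi fun p => (hψ p).trans (hφ p).symm

theorem theorem4p17 {B : Type*} [BooleanAlgebra B] [IsBooleanSigmaAlgebra B]
    {A : Type*} [CStarAlgebra A] [PartialOrder A] [StarOrderedRing A] [IsSigmaCStarAlgebra A] :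
    -- every POVM extends uniquely to a σ-cpu map, also among all positive maps
    (∀ μ : B → A, IsPOVM μ →
      (∃! φ : Linf B →CP A, IsSigmaCPU φ ∧ ∀ p, φ (Linf.chi p) = μ p) ∧
      (∀ (φ : Linf B →CP A) (ψ : Linf B →ₚ[ℂ] A), IsSigmaCPU φ → (∀ p, φ (Linf.chi p) = μ p) →
        (∀ p, ψ (Linf.chi p) = μ p) → ∀ f, ψ f = φ f)) ∧
    -- conversely, every σ-cpu map restricts to a POVM
    (∀ φ : Linf B →CP A, IsSigmaCPU φ → IsPOVM fun p => φ (Linf.chi p)) ∧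
    -- every PVM extends uniquely to a σ-homomorphism, also among all positive maps
    (∀ μ : B → A, IsPVM μ →
      (∃! φ : Linf B →⋆ₐ[ℂ] A, IsSigmaNormal φ ∧ ∀ p, φ (Linf.chi p) = μ p) ∧
      (∀ (φ : Linf B →⋆ₐ[ℂ] A) (ψ : Linf B →ₚ[ℂ] A), IsSigmaNormal φ →
        (∀ p, φ (Linf.chi p) = μ p) → (∀ p, ψ (Linf.chi p) = μ p) → ∀ f, ψ f = φ f)) ∧
    -- conversely, every σ-homomorphism restricts to a PVM
    (∀ φ : Linf B →⋆ₐ[ℂ] A, IsSigmaNormal φ → IsPVM fun p => φ (Linf.chi p)) :=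
  theorem4p17_general
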